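/- Let $\mathcal{G}$ be a Grothendieck category with a generating set $\mathfrak{p}=\{P_i\}_{i\in I}$ of small projective objects (an object $P$ is small if $\operatorname{Hom}(P,-)\colon\mathcal{G}\to\mathsf{Ab}$ preserves coproducts). Let $A=\bigoplus_{i,j\in I}\operatorname{Hom}(P_i,P_j)$, a ring with enough idempotents whose product is composition of morphisms, the complete set of orthogonal idempotents being $e_i=\mathrm{id}_{P_i}$. Write $A\text{-}\mathrm{Mod}$ and $A^{\mathrm{op}}\text{-}\mathrm{Mod}$ for the categories of unital left and right $A$-modules (those $M$ with $AM=M$, resp. $MA=M$), and let $$\Theta\colon\mathcal{G}\to A^{\mathrm{op}}\text{-}\mathrm{Mod},\qquad \Theta(X)=\bigoplus_{i\in I}\operatorname{Hom}(P_i,X).$$ For a unital left (right) $A$-module $M$, let $M^+$ be the unital right (left) $A$-module that is the largest unital submodule of $\operatorname{Hom}_{\mathbb{Z}}(M,\mathbb{Q}/\mathbb{Z})$, that is, $\bigoplus_i\operatorname{Hom}_{\mathbb{Z}}(e_iM,\mathbb{Q}/\mathbb{Z})$ (resp. $\bigoplus_i\operatorname{Hom}_{\mathbb{Z}}(Me_i,\mathbb{Q}/\mathbb{Z})$).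 Let $\operatorname{Tor}^A_i$ be the left derived functors of $\otimes_A\colon A^{\mathrm{op}}\text{-}\mathrm{Mod}\times A\text{-}\mathrm{Mod}\to\mathsf{Ab}$. For an abelian category $\mathcal{A}$ among $\mathcal{G}$, $A\text{-}\mathrm{Mod}$, $A^{\mathrm{op}}\text{-}\mathrm{Mod}$, let $\mathrm{FP}_0(\mathcal{A})$ be the class of finitely generated objects, and for $n\ge1$ let $\mathrm{FP}_n(\mathcal{A})$ be the class of objects $F$ such that $\operatorname{Ext}^i(F,-)$ preserves direct limits for $0\le i\le n-1$; write $\mathrm{FP}_n(A)=\mathrm{FP}_n(A\text{-}\mathrm{Mod})$. For a class $\mathcal{X}$ of objects of $\mathcal{A}$ put $\mathcal{X}^{\perp_1}=\{Y : \operatorname{Ext}^1(X,Y)=0\ \forall X\in\mathcal{X}\}$; the objects of $\mathrm{FP}_n(\mathcal{A})^{\perp_1}$ are called $\mathrm{FP}_n$-injective. For classes $\mathcal{C}$ of unital left $A$-modules and $\mathcal{C}'$ of objects of $\mathcal{G}$ put $${}^\top\mathcal{C}=\{N\in\mathcal{G} : \operatorname{Tor}^A_1(\Theta(N),M)=0\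 \forall M\in\mathcal{C}\},\qquad \mathcal{C}'^\top=\{M\in A\text{-}\mathrm{Mod} : \operatorname{Tor}^A_1(\Theta(N),M)=0\ \forall N\in\mathcal{C}'\}.$$ An object $N\in\mathcal{G}$ is $\mathrm{FP}_n$-flat if $N\in{}^\top\mathrm{FP}_n(A)$; a unital left $A$-module $M$ is $\mathrm{FP}_n$-flat if $\operatorname{Tor}^A_1(F,M)=0$ for every unital right $A$-module $F$ of type $\mathrm{FP}_n$. Then $\Theta$ is an equivalence of categories; let $\Theta^{-1}$ be a quasi-inverse. Let $n\ge0$, $\mathcal{C}\subseteq\mathrm{FP}_n(A)$ and $\mathcal{C}'\subseteq\mathrm{FP}_n(\mathcal{G})$. For all $N\in\mathcal{G}$ and $M\in A\text{-}\mathrm{Mod}$: (i) $N\in{}^\top\mathcal{C}$ if and only if $\Theta(N)^+\in\mathcal{C}^{\perp_1}$. In particular, $N$ is $\mathrm{FP}_n$-flat if and only if $\Theta(N)^+$ is $\mathrm{FP}_n$-injective. (ii) $M\in\mathcal{C}'^\top$ if and only if $\Theta^{-1}(M^+)\in\mathcal{C}'^{\perp_1}$. In particular, $M$ is $\mathrm{FP}_n$-flat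 if and only if $\Theta^{-1}(M^+)$ is $\mathrm{FP}_n$-injective. (iii) If $n\ge2$, then $M\in\mathcal{C}^{\perp_1}$ if and only if $\Theta^{-1}(M^+)\in{}^\top\mathcal{C}$. In particular, $M$ is $\mathrm{FP}_n$-injective if and only if $\Theta^{-1}(M^+)$ is $\mathrm{FP}_n$-flat. (iv) If $n\ge2$, then $N\in\mathcal{C}'^{\perp_1}$ if and only if $\Theta(N)^+\in\mathcal{C}'^\top$. In particular, $N$ is $\mathrm{FP}_n$-injective if and only if $\Theta(N)^+$ is $\mathrm{FP}_n$-flat. -/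

import Mathlib

open CategoryTheory Limits
open scoped TensorProduct DirectSum

universe w v u

noncomputable section

/-! ### Rings with enough idempotents and their unital modules -/

/-- A (possibly non-unital) ring with enough idempotents: there is a family of orthogonal
idempotents `e i` with `A = ⨁ e i A = ⨁ A e i`. The two sums are automatically direct, because
the idempotents are orthogonal, so it is enough to ask that they exhaust `A`. -/
class HasEnoughIdempotents (A : Type u) [NonUnitalRing A] : Prop where
  exists_complete : ∃ (I : Type u) (e : I → A), (∀ i, e i * e i = e i) ∧
    (∀ i j, i ≠ j → e i * e j = 0) ∧
    (⨆ i, (AddMonoidHom.mulLeft (e i)).range = ⊤) ∧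
    (⨆ i, (AddMonoidHom.mulRight (e i)).range = ⊤)

/-- The unital ring `ℤ ⊕ A` obtained from `A` by adjoining an identity. -/
def ZUnit (A : Type u) [NonUnitalRing A] : Type u := Unitization ℤ A

namespace ZUnit

variable {A : Type u} [NonUnitalRing A]

instance : Ring (ZUnit A) := inferInstanceAs (Ring (Unitization ℤ A))

/-- The inclusion of `A` in `ℤ ⊕ A`. -/
def of : A →ₙ+* ZUnit A where
  toFun a := (Unitization.inr a : Unitization ℤ A)
  map_zero' := Unitization.inr_zero ℤ
  map_add' := Unitization.inr_add ℤ
  map_mul' := Unitization.inr_mul ℤ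

/-- The integer component of an element of `ℤ ⊕ A`. -/
def fst (x : ZUnit A) : ℤ := (Unitization.toProd (R := ℤ) (A := A) x).1

/-- The component in `A` of an element of `ℤ ⊕ A`. -/
def snd (x : ZUnit A) : A := (Unitization.toProd (R := ℤ) (A := A) x).2

/-- A ring homomorphism from `A` to a unital ring extends to `ℤ ⊕ A`. -/
def lift {S : Type v} [Ring S] (f : A →ₙ+* S) : ZUnit A →+* S where
  toFun x := ((fst x : ℤ) : S) + f (snd x)
  map_one' := by
    have h1 : fst (1 : ZUnit A) = 1 := rfl
    have h2 : snd (1 : ZUnit A) = 0 := rfl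
    simp [h1, h2]
  map_zero' := by
    have h1 : fst (0 : ZUnit A) = 0 := rfl
    have h2 : snd (0 : ZUnit A) = 0 := rfl
    simp [h1, h2]
  map_add' x y := by
    have h1 : fst (x + y) = fst x + fst y := rfl
    have h2 : snd (x + y) = snd x + snd y := rfl
    rw [h1, h2, map_add]
    push_cast
    abel
  map_mul' x y := by
    have h1 : fst (x * y) = fst x * fst y := rfl
    have h2 : snd (x * y) = fst x • snd y +
      fst y • snd x + snd x * snd y := rfl
    rw [h1, h2]
    simp only [map_add, map_zsmul, map_mul, zsmul_eq_mul, Int.cast_mul, add_mul, mul_add]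
    rw [Int.cast_comm (fst y) (f (snd x))]
    abel

@[simp] lemma lift_of {S : Type v} [Ring S] (f : A →ₙ+* S) (a : A) : lift f (of a) = f a := by
  have h1 : fst (of a) = 0 := rfl
  have h2 : snd (of a) = a := rfl
  change ((fst (of a) : ℤ) : S) + f (snd (of a)) = f a
  simp [h1, h2]

lemma exists_eq (x : ZUnit A) : ∃ (n : ℤ) (a : A), x = n + of a := by
  refine ⟨fst x, snd x, ?_⟩
  have h (n : ℤ) : ((n : ℤ) : ZUnit A) = (Unitization.inl n : Unitization ℤ A) :=
    (eq_intCast (Unitization.inlRingHom ℤ A) n).symm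
  rw [h]
  exact (Unitization.inl_fst_add_inr_snd_eq x).symm

end ZUnit

/-- Left `A`-premodules: abelian groups `M` with an additive and associative action of the
non-unital ring `A`. This is the same thing as a module over `ℤ ⊕ A`, in which the action of
`a : A` on `m` is `ZUnit.of a • m`. Right `A`-premodules are `Premod Aᵐᵒᵖ`. -/
abbrev Premod (A : Type u) [NonUnitalRing A] := ModuleCat.{u} (ZUnit A)

/-- The premodule given by an abelian group and a multiplicative action of `A` by additive
endomorphisms. -/
def Premod.mk {A : Type u} [NonUnitalRing A] (M : Type u) [AddCommGroup M]
    (φ : A →ₙ+* AddMonoid.End M) : Premod A :=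
  letI : Module (ZUnit A) M := Module.compHom M (ZUnit.lift φ)
  ModuleCat.of (ZUnit A) M

lemma Premod.mk_smul {A : Type u} [NonUnitalRing A] (M : Type u) [AddCommGroup M]
    (φ : A →ₙ+* AddMonoid.End M) (a : A) (m : M) :
    (ZUnit.of a • (show Premod.mk M φ from m) : Premod.mk M φ) = φ a m :=
  congrArg (fun f : AddMonoid.End M ↦ f m) (ZUnit.lift_of φ a)

/-- The subgroup `A M` of a left `A`-premodule `M` generated by all products `a m`;
it is a sub-premodule. -/
def smulPart (A : Type u) [NonUnitalRing A] (M : Type u) [AddCommGroup M]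
    [Module (ZUnit A) M] : Submodule (ZUnit A) M :=
  Submodule.span _ {x | ∃ (a : A) (m : M), x = ZUnit.of a • m}

/-- The premodule `M` is unital: `A M = M`. -/
def isUnital (A : Type u) [NonUnitalRing A] : ObjectProperty (Premod A) :=
  fun M ↦ smulPart A M = ⊤

/-- The category `A-Mod` of unital left `A`-modules. The category of unital right `A`-modules
is `UMod Aᵐᵒᵖ`. -/
abbrev UMod (A : Type u) [NonUnitalRing A] := (isUnital A).FullSubcategory

section Unital

variable {A : Type u} [NonUnitalRing A]

lemma smul_mem_smulPart {M : Type u} [AddCommGroup M] [Module (ZUnit A) M]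
    (a : A) (m : M) : ZUnit.of a • m ∈ smulPart A M :=
  Submodule.subset_span ⟨a, m, rfl⟩

lemma isUnital_of_forall (M : Premod A)
    (h : ∀ m : M, ∃ a : A, ZUnit.of a • m = m) : isUnital A M := by
  refine eq_top_iff.2 fun m _ ↦ ?_
  obtain ⟨a, ha⟩ := h m
  rw [← ha]
  exact smul_mem_smulPart _ _

/-- In a ring with enough idempotents, every element has a local unit, compatibly. -/
lemma exists_family (A : Type u) [NonUnitalRing A] [HasEnoughIdempotents A] :
    ∃ (I : Type u) (e : I → A), (∀ i, e i * e i = e i) ∧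
      (∀ a : A, ∃ s : Finset I, ∀ t, s ⊆ t → (∑ i ∈ t, e i) * a = a) := by
  classical
  obtain ⟨I, e, h1, h2, h3, -⟩ := HasEnoughIdempotents.exists_complete (A := A)
  refine ⟨I, e, h1, fun a ↦ ?_⟩
  have ha : a ∈ ⨆ i, (AddMonoidHom.mulLeft (e i)).range := h3 ▸ AddSubgroup.mem_top a
  induction ha using AddSubgroup.iSup_induction' with
  | hp i x hx =>
    obtain ⟨y, rfl⟩ := hx
    refine ⟨{i}, fun t ht ↦ ?_⟩
    have hi : i ∈ t := by simpa using ht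
    rw [Finset.sum_mul, Finset.sum_eq_single_of_mem i hi]
    · simp [← mul_assoc, h1]
    · intro j _ hj
      simp [← mul_assoc, h2 j i hj]
  | h1 => exact ⟨∅, by simp⟩
  | hadd x y _ _ hx hy =>
    obtain ⟨s, hs⟩ := hx
    obtain ⟨s', hs'⟩ := hy
    refine ⟨s ∪ s', fun t ht ↦ ?_⟩
    rw [mul_add, hs t (Finset.union_subset_left ht), hs' t (Finset.union_subset_right ht)]

lemma exists_localUnit_of_mem {I : Type u} {e : I → A}
    (he : ∀ a : A, ∃ s : Finset I, ∀ t, s ⊆ t → (∑ i ∈ t, e i) * a = a)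
    {M : Type u} [AddCommGroup M] [Module (ZUnit A) M] {m : M} (hm : m ∈ smulPart A M) :
    ∃ s : Finset I, ∀ t, s ⊆ t → ZUnit.of (∑ i ∈ t, e i) • m = m := by
  classical
  refine Submodule.span_induction (p := fun m _ ↦ ∃ s : Finset I, ∀ t, s ⊆ t →
    ZUnit.of (∑ i ∈ t, e i) • m = m) ?_ ?_ ?_ ?_ hm
  · rintro x ⟨a, m, rfl⟩
    obtain ⟨s, hs⟩ := he a
    refine ⟨s, fun t ht ↦ ?_⟩
    rw [← mul_smul, ← map_mul, hs t ht]
  · exact ⟨∅, by simp⟩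
  · rintro x y _ _ ⟨s, hs⟩ ⟨s', hs'⟩
    refine ⟨s ∪ s', fun t ht ↦ ?_⟩
    rw [smul_add, hs t (Finset.union_subset_left ht), hs' t (Finset.union_subset_right ht)]
  · rintro r x _ ⟨s, hs⟩
    obtain ⟨n, a, rfl⟩ := r.exists_eq
    obtain ⟨s', hs'⟩ := he a
    refine ⟨s ∪ s', fun t ht ↦ ?_⟩
    have h1 := hs t (Finset.union_subset_left ht)
    have h2 := hs' t (Finset.union_subset_right ht)
    rw [add_smul, smul_add, ← mul_smul, ← mul_smul, ← map_mul, h2, ← Int.cast_comm, mul_smul, h1]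

variable [HasEnoughIdempotents A]

instance : (isUnital A).IsClosedUnderSubobjects where
  prop_of_mono {X Y} f _ hY := by
    obtain ⟨I, e, -, he⟩ := exists_family A
    refine isUnital_of_forall _ fun m ↦ ?_
    obtain ⟨s, hs⟩ := exists_localUnit_of_mem he (m := f.hom m) (by rw [hY]; trivial)
    refine ⟨∑ i ∈ s, e i, (ModuleCat.mono_iff_injective f).1 inferInstance ?_⟩
    exact (map_smul f.hom _ _).trans (hs s subset_rfl)

instance : (isUnital A).IsClosedUnderQuotients where
  prop_of_epi {X Y} f _ hX := by
    obtain ⟨I, e, -, he⟩ := exists_family A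
    refine isUnital_of_forall _ fun m ↦ ?_
    obtain ⟨x, rfl⟩ := (ModuleCat.epi_iff_surjective f).1 inferInstance m
    obtain ⟨s, hs⟩ := exists_localUnit_of_mem he (m := x) (by rw [hX]; trivial)
    refine ⟨∑ i ∈ s, e i, ?_⟩
    exact (map_smul f.hom _ _).symm.trans (congrArg f.hom (hs s subset_rfl))

instance : (isUnital A).ContainsZero where
  exists_zero := ⟨ModuleCat.of _ PUnit, ModuleCat.isZero_of_subsingleton _,
    isUnital_of_forall _ fun _ ↦ ⟨0, rfl⟩⟩

instance : (isUnital A).IsClosedUnderFiniteProducts where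
  isClosedUnderLimitsOfShape J _ := ⟨by
    classical
    rintro X ⟨h⟩
    have := Fintype.ofFinite J
    obtain ⟨I, e, -, he⟩ := exists_family A
    refine isUnital_of_forall _ fun m ↦ ?_
    have key (j : J) : ∃ s : Finset I, ∀ t, s ⊆ t → ZUnit.of (∑ i ∈ t, e i) •
        (h.π.app ⟨j⟩).hom m = (h.π.app ⟨j⟩).hom m :=
      exists_localUnit_of_mem he (by rw [h.prop_diag_obj]; trivial)
    choose s hs using key
    refine ⟨∑ i ∈ Finset.univ.biUnion s, e i, Concrete.isLimit_ext _ h.isLimit _ _ ?_⟩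
    rintro ⟨j⟩
    exact (map_smul (h.π.app ⟨j⟩).hom _ m).trans
      (hs j _ (Finset.subset_biUnion_of_mem s (Finset.mem_univ j)))⟩

/-- `A-Mod` is an abelian category. -/
instance : Abelian (UMod A) := inferInstance

instance : (isUnital A).ι.PreservesEpimorphisms :=
  (isUnital A).preservesEpimorphisms_ι_of_isNormalMonoCategory

lemma UMod.projective_of_module (M : UMod A) [Module.Projective (ZUnit A) M.obj] :
    Projective M where
  factors {E X} f g _ := by
    have : Epi g.hom := inferInstanceAs (Epi ((isUnital A).ι.map g))
    exact ⟨ObjectProperty.homMk (Projective.factorThru f.hom g.hom),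
      ObjectProperty.hom_ext _ (Projective.factorThru_comp f.hom g.hom)⟩

/-- `A-Mod` has enough projectives: every unital `M` is a quotient of a direct sum of copies of
the projective modules `A e i`. -/
instance : EnoughProjectives (UMod A) where
  presentation M := by
    obtain ⟨I, e, h1, he⟩ := exists_family A
    have heM := fun m : M.obj ↦ exists_localUnit_of_mem he (m := m) (by rw [M.property]; trivial)
    let F := (I × M.obj) →₀ ZUnit A
    let c : F →ₗ[ZUnit A] F := Finsupp.lsum ℕ fun k ↦
      (Finsupp.lsingle k).comp (LinearMap.toSpanSingleton _ _ (ZUnit.of (e k.1)))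
    have hc (k : I × M.obj) (x : ZUnit A) :
        c (Finsupp.single k x) = Finsupp.single k (x * ZUnit.of (e k.1)) :=
      (Finsupp.sum_single_index (by simp)).trans (by simp)
    have hcc (y : F) : c (c y) = c y := by
      induction y using Finsupp.induction_linear with
      | zero => simp
      | add y z hy hz => simp only [map_add, hy, hz]
      | single k x => rw [hc, hc, mul_assoc, ← map_mul, h1]
    let g : F →ₗ[ZUnit A] M.obj := Finsupp.lsum ℕ fun k ↦
      LinearMap.toSpanSingleton _ _ k.2
    have hg (k : I × M.obj) (x : ZUnit A) : g (Finsupp.single k x) = x • k.2 :=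
      (Finsupp.sum_single_index (by simp)).trans (by simp)
    let Q : Submodule (ZUnit A) F := LinearMap.range c
    have hproj : Module.Projective (ZUnit A) Q :=
      Module.Projective.of_split Q.subtype c.rangeRestrict (by
        ext ⟨_, y, rfl⟩ : 1
        exact Subtype.ext (hcc y))
    have hQ : isUnital A (ModuleCat.of _ Q) := by
      refine eq_top_iff.2 ?_
      rintro ⟨_, y, rfl⟩ -
      change c.rangeRestrict y ∈ smulPart A Q
      induction y using Finsupp.induction_linear with
      | zero => simp
      | add y z hy hz => rw [map_add]; exact add_mem hy hz
      | single k x =>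
        have : c.rangeRestrict (Finsupp.single k x) =
            x • (ZUnit.of (e k.1) • c.rangeRestrict (Finsupp.single k 1)) := by
          rw [← map_smul, ← map_smul]
          refine Subtype.ext ?_
          change c _ = c _
          rw [Finsupp.smul_single, Finsupp.smul_single, hc, hc]
          simp [mul_assoc, ← map_mul, h1]
        rw [this]
        exact Submodule.smul_mem _ _ (smul_mem_smulPart _ _)
    let Q' : UMod A := ⟨ModuleCat.of _ Q, hQ⟩
    have : Module.Projective (ZUnit A) Q'.obj := hproj
    let p : Q' ⟶ M := ObjectProperty.homMk (ModuleCat.ofHom (g.comp Q.subtype))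
    have hp : Epi ((isUnital A).ι.map p) := by
      refine (ModuleCat.epi_iff_surjective _).2 fun m ↦ ?_
      obtain ⟨s, hs⟩ := heM m
      refine ⟨c.rangeRestrict (∑ i ∈ s, Finsupp.single (i, m) 1), ?_⟩
      change g (c _) = m
      conv_rhs => rw [← hs s subset_rfl]
      simp only [map_sum, hc, hg, one_mul, Finset.sum_smul]
    exact ⟨{ p := Q', projective := UMod.projective_of_module Q', f := p
             epi := (isUnital A).ι.epi_of_epi_map hp }⟩

instance : HasExt.{u} (UMod A) := hasExt_of_enoughProjectives _

/-- The ring opposite to a ring with enough idempotents has enough idempotents. -/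
instance : HasEnoughIdempotents Aᵐᵒᵖ where
  exists_complete := by
    obtain ⟨I, e, h1, h2, h3, h4⟩ := HasEnoughIdempotents.exists_complete (A := A)
    refine ⟨I, fun i ↦ MulOpposite.op (e i), fun i ↦ by rw [← MulOpposite.op_mul, h1],
      fun i j h ↦ by rw [← MulOpposite.op_mul, h2 j i h.symm, MulOpposite.op_zero], ?_, ?_⟩
    · refine eq_top_iff.2 fun x _ ↦ ?_
      have hx : x.unop ∈ ⨆ i, (AddMonoidHom.mulRight (e i)).range := h4 ▸ AddSubgroup.mem_top _
      rw [← MulOpposite.op_unop x]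
      generalize x.unop = a at hx
      induction hx using AddSubgroup.iSup_induction' with
      | hp i x hx =>
        obtain ⟨y, rfl⟩ := hx
        exact AddSubgroup.mem_iSup_of_mem i ⟨MulOpposite.op y, rfl⟩
      | h1 => exact zero_mem _
      | hadd x y _ _ hx hy => exact add_mem hx hy
    · refine eq_top_iff.2 fun x _ ↦ ?_
      have hx : x.unop ∈ ⨆ i, (AddMonoidHom.mulLeft (e i)).range := h3 ▸ AddSubgroup.mem_top _
      rw [← MulOpposite.op_unop x]
      generalize x.unop = a at hx
      induction hx using AddSubgroup.iSup_induction' with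
      | hp i x hx =>
        obtain ⟨y, rfl⟩ := hx
        exact AddSubgroup.mem_iSup_of_mem i ⟨MulOpposite.op y, rfl⟩
      | h1 => exact zero_mem _
      | hadd x y _ _ hx hy => exact add_mem hx hy

/-! ### Character modules -/

/-- The biggest unital submodule `A M = ⨁ e i M` of a premodule `M`. -/
def unitalPart (M : Premod A) : UMod A where
  obj := ModuleCat.of (ZUnit A) (smulPart A M)
  property := by
    obtain ⟨I, e, -, he⟩ := exists_family A
    refine isUnital_of_forall _ ?_
    rintro ⟨m, hm⟩
    obtain ⟨s, hs⟩ := exists_localUnit_of_mem he hm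
    exact ⟨∑ i ∈ s, e i, Subtype.ext (hs s subset_rfl)⟩

end Unital

/-- For an `A`-premodule `M` and a homomorphism `φ : B → Aᵐᵒᵖ`, the action of `B` on
`Hom_ℤ(M, ℚ/ℤ)` given by `(b • f) m = f (φ b • m)`. -/
def charAction {A B : Type u} [NonUnitalRing A] [NonUnitalRing B] (φ : B →ₙ+* Aᵐᵒᵖ)
    (M : Premod A) : B →ₙ+* AddMonoid.End (M →+ AddCircle (1 : ℚ)) where
  toFun b :=
    { toFun := fun f ↦ f.comp (Module.toAddMonoidEnd (ZUnit A) M (ZUnit.of (φ b).unop))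
      map_zero' := rfl
      map_add' := fun _ _ ↦ rfl }
  map_zero' := by
    ext f m
    change f (ZUnit.of (φ 0).unop • m) = 0
    simp
  map_add' b b' := by
    ext f m
    change f (ZUnit.of (φ (b + b')).unop • m) =
      f (ZUnit.of (φ b).unop • m) + f (ZUnit.of (φ b').unop • m)
    simp [add_smul]
  map_mul' b b' := by
    ext f m
    change f (ZUnit.of (φ (b * b')).unop • m) =
      f (ZUnit.of (φ b').unop • ZUnit.of (φ b).unop • m)
    simp [mul_smul]

/-- The character module `M⁺` of a unital left `A`-module: the biggest unital submodule of the
right premodule `Hom_ℤ(M, ℚ/ℤ)`, where `(f a)(m) = f (a m)`. -/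
def UMod.char {A : Type u} [NonUnitalRing A] [HasEnoughIdempotents A] (M : UMod A) :
    UMod Aᵐᵒᵖ :=
  unitalPart (Premod.mk (M.obj →+ AddCircle (1 : ℚ)) (charAction (.id _) M.obj))

/-- The character module `N⁺` of a unital right `A`-module: the biggest unital submodule of the
left premodule `Hom_ℤ(N, ℚ/ℤ)`, where `(a f)(n) = f (n a)`. -/
def UMod.charOp {A : Type u} [NonUnitalRing A] [HasEnoughIdempotents A] (N : UMod Aᵐᵒᵖ) :
    UMod A :=
  unitalPart (Premod.mk (N.obj →+ AddCircle (1 : ℚ))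
    (charAction (RingEquiv.opOp A : A →ₙ+* Aᵐᵒᵖᵐᵒᵖ) N.obj))

/-! ### Tensor products and Tor -/

section Tensor

variable {A : Type u} [NonUnitalRing A]

/-- The subgroup of `N ⊗_ℤ M` generated by the elements `n a ⊗ m - n ⊗ a m`. -/
def balancing (N : UMod Aᵐᵒᵖ) (M : UMod A) : AddSubgroup (N.obj ⊗[ℤ] M.obj) :=
  AddSubgroup.closure {z | ∃ (n : N.obj) (a : A) (m : M.obj),
    z = (ZUnit.of (MulOpposite.op a) • n) ⊗ₜ[ℤ] m - n ⊗ₜ[ℤ] (ZUnit.of a • m)}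

/-- The tensor product `N ⊗_A M`. -/
abbrev TensorA (N : UMod Aᵐᵒᵖ) (M : UMod A) : Type u := (N.obj ⊗[ℤ] M.obj) ⧸ balancing N M

lemma TensorA.hom_ext {N : UMod Aᵐᵒᵖ} {M : UMod A} {T : Type v} [AddCommGroup T]
    {f g : TensorA N M →+ T}
    (h : ∀ n m, f (QuotientAddGroup.mk (n ⊗ₜ[ℤ] m)) = g (QuotientAddGroup.mk (n ⊗ₜ[ℤ] m))) :
    f = g := by
  refine QuotientAddGroup.addMonoidHom_ext _ (AddMonoidHom.ext fun x ↦ ?_)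
  induction x using TensorProduct.induction_on with
  | zero => rw [map_zero, map_zero]
  | tmul n m => exact h n m
  | add x y hx hy => rw [map_add, map_add, hx, hy]

/-- The map `N ⊗_A M → N ⊗_A M'`, `n ⊗ m ↦ n ⊗ f m`. -/
def TensorA.map (N : UMod Aᵐᵒᵖ) {M M' : UMod A} (f : M ⟶ M') : TensorA N M →+ TensorA N M' :=
  QuotientAddGroup.map _ _
    (TensorProduct.map (LinearMap.id (R := ℤ) (M := N.obj))
      (f.hom.hom.toAddMonoidHom.toIntLinearMap)).toAddMonoidHom (by
        rw [balancing, AddSubgroup.closure_le]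
        rintro _ ⟨n, a, m, rfl⟩
        refine AddSubgroup.subset_closure ⟨n, a, f.hom.hom m, ?_⟩
        simp)

/-- The functor `N ⊗_A -` from unital left `A`-modules to abelian groups. -/
def tensorFunctor (N : UMod Aᵐᵒᵖ) : UMod A ⥤ AddCommGrpCat.{u} where
  obj M := AddCommGrpCat.of (TensorA N M)
  map f := AddCommGrpCat.ofHom (TensorA.map N f)
  map_id _ := AddCommGrpCat.hom_ext (TensorA.hom_ext fun _ _ ↦ rfl)
  map_comp _ _ := AddCommGrpCat.hom_ext (TensorA.hom_ext fun _ _ ↦ rfl)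

instance (N : UMod Aᵐᵒᵖ) : (tensorFunctor N).Additive where
  map_add {_ _ _ _} := AddCommGrpCat.hom_ext (TensorA.hom_ext fun _ _ ↦
    congrArg (QuotientAddGroup.mk' (balancing N _)) (TensorProduct.tmul_add _ _ _))

/-- `Tor_i^A(N, M)` for a unital right `A`-module `N` and a unital left `A`-module `M`: the left
derived functors of `N ⊗_A -`. -/
def tor [HasEnoughIdempotents A] (i : ℕ) (N : UMod Aᵐᵒᵖ) (M : UMod A) : AddCommGrpCat.{u} :=
  ((tensorFunctor N).leftDerived i).obj M

end Tensor

/-! ### The induced ring and the functor `Θ` -/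

section Theta

variable {G : Type u} [Category.{v} G] [Preadditive G] {I : Type v} (P : I → G)

/-- The abelian group `⨁ i, Hom(P i, X)`. -/
abbrev HomSum (X : G) : Type v := ⨁ i, (P i ⟶ X)

namespace HomSum

variable {P}

/-- The inclusion of `Hom(P i, X)` in `⨁ i, Hom(P i, X)`. -/
def single {i : I} {X : G} : (P i ⟶ X) →+ HomSum P X :=
  let := Classical.decEq I
  DirectSum.of (fun i ↦ (P i ⟶ X)) i

lemma induction {X : G} {p : HomSum P X → Prop} (x : HomSum P X) (zero : p 0)
    (single : ∀ (i : I) (f : P i ⟶ X), p (single f)) (add : ∀ x y, p x → p y → p (x + y)) :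
    p x := by
  let := Classical.decEq I
  exact DirectSum.induction_on x zero single add

/-- Postcomposition with `f : X ⟶ Y` on `⨁ i, Hom(P i, X)`. -/
def map {X Y : G} (f : X ⟶ Y) : HomSum P X →+ HomSum P Y :=
  DirectSum.map fun i ↦ Preadditive.rightComp (P i) f

@[simp] lemma map_single {X Y : G} (f : X ⟶ Y) {i : I} (g : P i ⟶ X) :
    map f (single g) = single (g ≫ f) := by
  classical
  exact DirectSum.map_of _ _ _

lemma map_add {X Y : G} (f g : X ⟶ Y) (x : HomSum P X) : map (f + g) x = map f x + map g x := by
  ext i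
  exact Preadditive.comp_add _ _ _ (x i) f g

lemma map_id {X : G} (x : HomSum P X) : map (𝟙 X) x = x := by
  ext i
  exact Category.comp_id (x i)

lemma map_comp {X Y Z : G} (f : X ⟶ Y) (g : Y ⟶ Z) (x : HomSum P X) :
    map (f ≫ g) x = map g (map f x) := by
  ext i
  exact (Category.assoc (x i) f g).symm

end HomSum

/-- The underlying abelian group `⨁ i j, Hom(P i, P j)` of the ring induced by the family `P`:
the component at `j` of an element is the family of its components in `Hom(P i, P j)`, `i : I`. -/
def IndRing : Type v := ⨁ j, HomSum P (P j)

namespace IndRing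

instance : AddCommGroup (IndRing P) := inferInstanceAs (AddCommGroup (⨁ j, HomSum P (P j)))

variable {P}

/-- The family of the components in `Hom(P i, P j)`, `i : I`, of an element of the induced ring. -/
def row (a : IndRing P) (j : I) : HomSum P (P j) :=
  (show ⨁ j, HomSum P (P j) from a) j

/-- The inclusion of `⨁ i, Hom(P i, P j)` in `⨁ i j, Hom(P i, P j)`. -/
def ofRow {j : I} : HomSum P (P j) →+ IndRing P :=
  let := Classical.decEq I
  DirectSum.of (fun j ↦ HomSum P (P j)) j

lemma ext {a b : IndRing P} (h : ∀ j, a.row j = b.row j) : a = b :=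
  DirectSum.ext (β := fun j ↦ HomSum P (P j)) h

lemma row_add (a b : IndRing P) (j : I) : (a + b).row j = a.row j + b.row j := rfl

lemma row_zero (j : I) : (0 : IndRing P).row j = 0 := rfl

@[simp] lemma row_ofRow {j : I} (x : HomSum P (P j)) : (ofRow x).row j = x := by
  classical
  exact DirectSum.of_eq_same _ _

lemma row_ofRow_of_ne {j k : I} (x : HomSum P (P j)) (h : k ≠ j) : (ofRow x).row k = 0 := by
  classical
  exact DirectSum.of_eq_of_ne _ _ _ h

lemma induction {p : IndRing P → Prop} (a : IndRing P) (zero : p 0)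
    (single : ∀ (i j : I) (f : P i ⟶ P j), p (ofRow (HomSum.single f)))
    (add : ∀ a b, p a → p b → p (a + b)) : p a := by
  let := Classical.decEq I
  refine DirectSum.induction_on (β := fun j ↦ HomSum P (P j)) a zero (fun j x ↦ ?_) add
  change p (ofRow x)
  refine HomSum.induction (p := fun x ↦ p (ofRow x)) x ?_ (fun i f ↦ single i j f)
    fun x y hx hy ↦ ?_
  · rwa [_root_.map_zero]
  · rw [_root_.map_add]
    exact add _ _ hx hy

end IndRing

namespace HomSum

variable {P}

/-- The right action of the induced ring on `⨁ i, Hom(P i, X)` by composition: it is determined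
by `f * g = g ≫ f` for `f : P j ⟶ X` and `g : P i ⟶ P j`, other products being zero. -/
def act {X : G} (a : IndRing P) : HomSum P X →+ HomSum P X :=
  let := Classical.decEq I
  DirectSum.toAddMonoid fun j ↦ AddMonoidHom.mk' (fun f : P j ⟶ X ↦ map f (a.row j))
    fun f g ↦ map_add f g _

@[simp] lemma act_single {X : G} (a : IndRing P) {j : I} (f : P j ⟶ X) :
    act a (single f) = map f (a.row j) := by
  classical
  exact DirectSum.toAddMonoid_of _ _ _

lemma act_add {X : G} (a b : IndRing P) (x : HomSum P X) :
    act (a + b) x = act a x + act b x := by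
  induction x using HomSum.induction with
  | zero => simp only [_root_.map_zero, add_zero]
  | single j f => simp [IndRing.row_add]
  | add x y hx hy =>
    simp only [_root_.map_add, hx, hy]
    abel

lemma act_zero {X : G} (x : HomSum P X) : act (0 : IndRing P) x = 0 := by
  induction x using HomSum.induction with
  | zero => simp only [_root_.map_zero]
  | single j f => simp [IndRing.row_zero]
  | add x y hx hy =>
    simp only [_root_.map_add, hx, hy, add_zero]

lemma act_map {X Y : G} (a : IndRing P) (f : X ⟶ Y) (x : HomSum P X) :
    act a (map f x) = map f (act a x) := by
  induction x using HomSum.induction with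
  | zero => simp only [_root_.map_zero]
  | single j g => simp [map_comp]
  | add x y hx hy =>
    simp only [_root_.map_add, hx, hy]

end HomSum

namespace IndRing

variable {P}

/-- The product of the induced ring is given by composition: `f * g = g ≫ f` for `f : P j ⟶ P k`
and `g : P i ⟶ P j`, and products of non-composable morphisms are zero. -/
def mulHom (b : IndRing P) : IndRing P →+ IndRing P :=
  DirectSum.map (β := fun j ↦ HomSum P (P j)) fun _ ↦ HomSum.act b

instance : Mul (IndRing P) := ⟨fun a b ↦ mulHom b a⟩

lemma row_mul (a b : IndRing P) (j : I) : (a * b).row j = HomSum.act b (a.row j) := rfl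

lemma act_mul {X : G} (a b : IndRing P) (x : HomSum P X) :
    HomSum.act (a * b) x = HomSum.act b (HomSum.act a x) := by
  induction x using HomSum.induction with
  | zero => simp only [_root_.map_zero]
  | single j f => simp [row_mul, HomSum.act_map]
  | add x y hx hy =>
    simp only [_root_.map_add, hx, hy]

instance : NonUnitalRing (IndRing P) where
  left_distrib a b c := ext fun j ↦ by simp only [row_mul, row_add, HomSum.act_add]
  right_distrib a b c := ext fun j ↦ by simp only [row_mul, row_add, map_add]
  zero_mul a := ext fun j ↦ by simp only [row_mul, row_zero, map_zero]
  mul_zero a := ext fun j ↦ by simp only [row_mul, row_zero, HomSum.act_zero]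
  mul_assoc a b c := ext fun j ↦ by simp only [row_mul, act_mul]

/-- The element of the induced ring given by a morphism `P i ⟶ P j`. -/
def ofHom {i j : I} (f : P i ⟶ P j) : IndRing P := ofRow (HomSum.single f)

lemma ofHom_mul_ofHom {i j k : I} (f : P j ⟶ P k) (g : P i ⟶ P j) :
    ofHom f * ofHom g = ofHom (g ≫ f) := by
  refine ext fun l ↦ ?_
  rw [row_mul]
  by_cases h : l = k
  · subst h
    simp [ofHom]
  · simp [ofHom, row_ofRow_of_ne _ h]

lemma ofHom_mul_ofHom_of_ne {i j j' k : I} (f : P j ⟶ P k) (g : P i ⟶ P j') (h : j ≠ j') :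
    ofHom f * ofHom g = 0 := by
  refine ext fun l ↦ ?_
  rw [row_mul]
  by_cases hl : l = k
  · subst hl
    simp [ofHom, row_ofRow_of_ne _ h, row_zero]
  · simp [ofHom, row_ofRow_of_ne _ hl, row_zero]

/-- The identities of the objects `P i` form a complete set of idempotents of the induced ring. -/
instance : HasEnoughIdempotents (IndRing P) where
  exists_complete := by
    refine ⟨I, fun i ↦ ofHom (𝟙 (P i)), fun i ↦ by rw [ofHom_mul_ofHom, Category.comp_id],
      fun i j h ↦ ofHom_mul_ofHom_of_ne _ _ h, ?_, ?_⟩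
    · refine eq_top_iff.2 fun a _ ↦ induction a (zero_mem _) (fun i j f ↦ ?_)
        fun _ _ ↦ add_mem
      exact AddSubgroup.mem_iSup_of_mem j ⟨ofHom f, by
        exact (ofHom_mul_ofHom (𝟙 (P j)) f).trans (by rw [Category.comp_id]; rfl)⟩
    · refine eq_top_iff.2 fun a _ ↦ induction a (zero_mem _) (fun i j f ↦ ?_)
        fun _ _ ↦ add_mem
      exact AddSubgroup.mem_iSup_of_mem i ⟨ofHom f, by
        exact (ofHom_mul_ofHom f (𝟙 (P i))).trans (by rw [Category.id_comp]; rfl)⟩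

end IndRing

/-- The right action of the induced ring on `⨁ i, Hom(P i, X)`. -/
def thetaAction (X : G) : (IndRing P)ᵐᵒᵖ →ₙ+* AddMonoid.End (HomSum P X) where
  toFun a := HomSum.act a.unop
  map_zero' := AddMonoidHom.ext fun x ↦ HomSum.act_zero x
  map_add' a b := AddMonoidHom.ext fun x ↦ HomSum.act_add a.unop b.unop x
  map_mul' a b := AddMonoidHom.ext fun x ↦ IndRing.act_mul b.unop a.unop x

/-- The unital right module `Θ(X) = ⨁ i, Hom(P i, X)` over the induced ring. -/
def thetaObj (X : G) : UMod (IndRing P)ᵐᵒᵖ where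
  obj := Premod.mk (HomSum P X) (thetaAction P X)
  property := by
    refine eq_top_iff.2 fun (x : HomSum P X) _ ↦ ?_
    refine HomSum.induction (p := fun x ↦ (show Premod.mk (HomSum P X) (thetaAction P X) from x) ∈
      smulPart (IndRing P)ᵐᵒᵖ (Premod.mk (HomSum P X) (thetaAction P X))) x (zero_mem _)
      (fun i f ↦ ?_) fun _ _ ↦ add_mem
    have h := smul_mem_smulPart (A := (IndRing P)ᵐᵒᵖ)
      (M := Premod.mk (HomSum P X) (thetaAction P X))
      (MulOpposite.op (IndRing.ofHom (𝟙 (P i)))) (HomSum.single f)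
    rw [Premod.mk_smul] at h
    have : thetaAction P X (MulOpposite.op (IndRing.ofHom (𝟙 (P i)))) (HomSum.single f) =
        HomSum.single f := by
      change HomSum.act _ _ = _
      simp [IndRing.ofHom]
    rwa [this] at h

/-- An additive map commuting with the action of `A` is a morphism of premodules. -/
def Premod.homMk {A : Type v} [NonUnitalRing A] {M M' : Premod A} (f : M →+ M')
    (h : ∀ (a : A) (m : M), f (ZUnit.of a • m) = ZUnit.of a • f m) : M ⟶ M' :=
  ModuleCat.ofHom
    { f with
      map_smul' := fun r m ↦ by
        obtain ⟨n, a, rfl⟩ := r.exists_eq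
        change f _ = ((n : ZUnit A) + ZUnit.of a) • f m
        rw [add_smul, add_smul, map_add, h, Int.cast_smul_eq_zsmul, Int.cast_smul_eq_zsmul,
          map_zsmul] }

/-- The functor `Θ : G ⥤ Aᵒᵖ-Mod`, `X ↦ ⨁ i, Hom(P i, X)`, from `G` to unital right modules over
the induced ring. -/
def theta : G ⥤ UMod (IndRing P)ᵐᵒᵖ where
  obj X := thetaObj P X
  map {X Y} f := ObjectProperty.homMk (Premod.homMk
    (M := (thetaObj P X).obj) (M' := (thetaObj P Y).obj) (HomSum.map f) fun a m ↦ by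
      refine (congrArg (HomSum.map f) (Premod.mk_smul _ (thetaAction P X) a m)).trans
        (Eq.trans ?_ (Premod.mk_smul _ (thetaAction P Y) a (HomSum.map f m)).symm)
      exact (HomSum.act_map a.unop f m).symm)
  map_id X := ObjectProperty.hom_ext _ (ModuleCat.hom_ext (LinearMap.ext HomSum.map_id))
  map_comp f g := ObjectProperty.hom_ext _ (ModuleCat.hom_ext (LinearMap.ext
    (HomSum.map_comp f g)))

end Theta

/-! ### Objects of type `FP_n`, orthogonal classes -/

/-- The class `FP_n(C)` of objects of type `FP_n` of an abelian category. For `n = 0`, these are the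
finitely generated objects: if the object is the supremum of a directed family of subobjects, then
it is a member of the family. For `n ≥ 1`, these are the objects `F` such that `Ext^i(F, -)`
preserves direct limits for all `i ≤ n - 1`. -/
def isFP (C : Type u) [Category.{v} C] [Abelian C] [HasExt.{v} C] : ℕ → ObjectProperty C
  | 0 => fun F ↦ IsCompactElement (⊤ : Subobject F)
  | n + 1 => fun F ↦ ∀ i ≤ n, PreservesFilteredColimits (Abelian.extFunctorObj F i)

/-- The class of objects `M` with `Ext^1(F, M) = 0` for all `F` in the class `𝒞`. -/
def perpOne {C : Type u} [Category.{v} C] [Abelian C] [HasExt.{v} C] (𝒞 : ObjectProperty C) :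
    ObjectProperty C :=
  fun M ↦ ∀ F, 𝒞 F → Subsingleton (Abelian.Ext F M 1)

/-- `M` is `FP_n`-injective: `Ext^1(F, M) = 0` for all `F` of type `FP_n`. -/
def isFPInjective (C : Type u) [Category.{v} C] [Abelian C] [HasExt.{v} C] (n : ℕ) :
    ObjectProperty C :=
  perpOne (isFP C n)

/-- A unital left `A`-module `M` is `FP_n`-flat if `Tor_1^A(F, M) = 0` for all unital right
`A`-modules `F` of type `FP_n`. -/
def isFPFlatModule (A : Type v) [NonUnitalRing A] [HasEnoughIdempotents A] (n : ℕ) :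
    ObjectProperty (UMod A) :=
  fun M ↦ ∀ F, isFP (UMod Aᵐᵒᵖ) n F → Subsingleton (tor 1 F M)

section Grothendieck

variable {G : Type u} [Category.{v} G] [Abelian G] {I : Type v} (P : I → G)

/-- The class `^⊤𝒞` of the objects `N` of `G` with `Tor_1^A(Θ(N), M) = 0` for all `M` in the
class `𝒞` of unital left `A`-modules. -/
def leftTop (𝒞 : ObjectProperty (UMod (IndRing P))) : ObjectProperty G :=
  fun N ↦ ∀ M, 𝒞 M → Subsingleton (tor 1 ((theta P).obj N) M)

/-- The class `𝒞'^⊤` of the unital left `A`-modules `M` with `Tor_1^A(Θ(N), M) = 0` for all `N` in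
the class `𝒞'` of objects of `G`. -/
def rightTop (𝒞' : ObjectProperty G) : ObjectProperty (UMod (IndRing P)) :=
  fun M ↦ ∀ N, 𝒞' N → Subsingleton (tor 1 ((theta P).obj N) M)

/-- An object `N` of `G` is `FP_n`-flat if `Tor_1^A(Θ(N), F) = 0` for all unital left `A`-modules
`F` of type `FP_n`. -/
def isFPFlat (n : ℕ) : ObjectProperty G :=
  leftTop P (isFP (UMod (IndRing P)) n)

/-- The family `P` is a generating family of small projective objects of `G`. An object `X` is
small if `Hom(X, -) : G ⥤ Ab` preserves coproducts. -/
structure IsSmallProjectiveGenerating : Prop where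
  isSeparating : (ObjectProperty.ofObj P).IsSeparating
  projective (i : I) : Projective (P i)
  small (i : I) (J : Type v) :
    PreservesColimitsOfShape (Discrete J) (preadditiveCoyoneda.obj (Opposite.op (P i)))

end Grothendieck

end

/-! Everything rests on one adjunction and one comparison map. A character of `N ⊗_A M` is a
balanced pairing of `N` and `M` with values in ℚ/ℤ, hence a morphism `M ⟶ N⁺`, and equally a
morphism `N ⟶ M⁺`. Since ℚ/ℤ is an injective cogenerator, a complex of abelian groups is exact
exactly when its character complex is. Applied to `N ⊗_A R`, for a projective resolution `R` of `M`,
this shows that Tor_1(N, M) vanishes iff Ext^1(M, N⁺) does (`subsingleton_tor_one_iff`). Exchanging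
the two sides of a pairing turns a projective presentation of `M` into an injective copresentation
of `M⁺`, so this is also equivalent to the vanishing of Ext^1(N, M⁺)
(`subsingleton_ext_charMod_comm`). Parts (i) and (ii) follow.

By the same duality, parts (iii) and (iv) amount to saying that, for `F` of type FP_2, Ext^1(F, M)
vanishes iff Ext^1(F, M⁺⁺) does (`subsingleton_ext_bidual_iff`). Writing * for the character group,
there is a natural map Hom(K, M)** → Hom(K, M⁺⁺) (`bidualComparison`). For K = Ae both sides are the
double dual of eM. Hence the map is bijective for finitely generated projective `K` and, by right
exactness, for finitely presented `K`. An `F` of type FP_2 has a presentation 0 → K → P → F → 0 with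
`P` finitely generated projective and `K` a direct summand of a finitely presented module
(`exists_shortExact_of_isFP`). Here Ext^1(F, -) vanishes iff Hom(P, -) → Hom(K, -) is surjective,
and a map of abelian groups is surjective iff its double dual is.

To pass between `G` and right modules, `Θ` is shown to be an equivalence. It is faithful because the
`P i` generate. Smallness computes Hom(P i, -) on coproducts, so morphisms can be defined on
coproducts of the `P i` and descended, and every module is `Θ` of a cokernel of a map between such
coproducts. Equivalences preserve Ext and type FP_n. -/

noncomputable section

/-! ### Extensions and short exact sequences -/

section Ext

variable {C : Type u} [Category.{v} C] [Abelian C] [HasExt.{w} C]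

/-- The first extension group of the cokernel of `S` vanishes iff morphisms extend along `S.f`, if
the middle object is projective. -/
lemma subsingleton_ext_one_iff_of_projective {S : ShortComplex C} (hS : S.ShortExact)
    [Projective S.X₂] (Y : C) :
    Subsingleton (Abelian.Ext S.X₃ Y 1) ↔ ∀ f : S.X₁ ⟶ Y, ∃ g : S.X₂ ⟶ Y, S.f ≫ g = f := by
  constructor
  · intro h f
    obtain ⟨x, hx⟩ := Abelian.Ext.contravariant_sequence_exact₁ hS Y (Abelian.Ext.mk₀ f)
      (add_zero 1) (Subsingleton.elim _ _)
    obtain ⟨g, rfl⟩ := (Abelian.Ext.mk₀_bijective _ _).2 x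
    refine ⟨g, (Abelian.Ext.mk₀_bijective _ _).1 ?_⟩
    rw [← hx, Abelian.Ext.mk₀_comp_mk₀]
  · intro h
    refine subsingleton_of_forall_eq 0 fun x ↦ ?_
    obtain ⟨y, hy⟩ := Abelian.Ext.contravariant_sequence_exact₃ hS Y x
      (Abelian.Ext.eq_zero_of_projective _) (add_zero 1)
    obtain ⟨f, rfl⟩ := (Abelian.Ext.mk₀_bijective _ _).2 y
    obtain ⟨g, rfl⟩ := h f
    rw [← hy, ← Abelian.Ext.mk₀_comp_mk₀, ← Abelian.Ext.comp_assoc _ _ _ (add_zero 1) (add_zero 0)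
      (by simp), hS.extClass_comp, Abelian.Ext.zero_comp]

/-- The first extension group with values in the kernel of `S` vanishes iff morphisms lift along
`S.g`, if the middle object is injective. -/
lemma subsingleton_ext_one_iff_of_injective {S : ShortComplex C} (hS : S.ShortExact)
    [Injective S.X₂] (X : C) :
    Subsingleton (Abelian.Ext X S.X₁ 1) ↔ ∀ f : X ⟶ S.X₃, ∃ g : X ⟶ S.X₂, g ≫ S.g = f := by
  constructor
  · intro h f
    obtain ⟨x, hx⟩ := Abelian.Ext.covariant_sequence_exact₃ X hS (Abelian.Ext.mk₀ f)
      (zero_add 1) (Subsingleton.elim _ _)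
    obtain ⟨g, rfl⟩ := (Abelian.Ext.mk₀_bijective _ _).2 x
    refine ⟨g, (Abelian.Ext.mk₀_bijective _ _).1 ?_⟩
    rw [← hx, Abelian.Ext.mk₀_comp_mk₀]
  · intro h
    refine subsingleton_of_forall_eq 0 fun x ↦ ?_
    obtain ⟨y, hy⟩ := Abelian.Ext.covariant_sequence_exact₁ X hS x
      (Abelian.Ext.eq_zero_of_injective _) (zero_add 1)
    obtain ⟨f, rfl⟩ := (Abelian.Ext.mk₀_bijective _ _).2 y
    obtain ⟨g, rfl⟩ := h f
    rw [← hy, ← Abelian.Ext.mk₀_comp_mk₀, Abelian.Ext.comp_assoc _ _ _ (add_zero 0) (zero_add 1)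
      (by simp), hS.comp_extClass, Abelian.Ext.comp_zero]

/-- If `Ext^1(S.X₃, -)` preserves a filtered colimit, and morphisms from the projective object
`S.X₂` to the colimit factor through a stage, then so do morphisms from `S.X₁`. -/
lemma exists_factor_of_preservesColimit_ext {S : ShortComplex C} (hS : S.ShortExact)
    [Projective S.X₂] {J : Type w} [SmallCategory J] [IsFiltered J] {D : J ⥤ C}
    [PreservesColimit D (Abelian.extFunctorObj S.X₃ 1)] {c : Cocone D} (hc : IsColimit c)
    (hP : ∀ g : S.X₂ ⟶ c.pt, ∃ (j : J) (g' : S.X₂ ⟶ D.obj j), g' ≫ c.ι.app j = g)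
    (f : S.X₁ ⟶ c.pt) : ∃ (j : J) (f' : S.X₁ ⟶ D.obj j), f' ≫ c.ι.app j = f := by
  -- The connecting class δ(f) in Ext^1(X₃, colim D) comes from a class at some stage `j`. That
  -- class is δ(a) for some `a`, since Ext^1(X₂, -) = 0.
  obtain ⟨j, x, hx⟩ := Concrete.isColimit_exists_rep _
    (isColimitOfPreserves (Abelian.extFunctorObj S.X₃ 1) hc)
    (hS.extClass.comp (Abelian.Ext.mk₀ f) (add_zero 1))
  obtain ⟨y, hy⟩ := Abelian.Ext.contravariant_sequence_exact₃ hS _ (x : Abelian.Ext S.X₃ _ 1)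
    (Abelian.Ext.eq_zero_of_projective _) (add_zero 1)
  obtain ⟨a, rfl⟩ := (Abelian.Ext.mk₀_bijective _ _).2 y
  have hx' : hS.extClass.comp (Abelian.Ext.mk₀ (a ≫ c.ι.app j)) (add_zero 1) =
      hS.extClass.comp (Abelian.Ext.mk₀ f) (add_zero 1) := by
    rw [← hx, ← hy, ← Abelian.Ext.mk₀_comp_mk₀, ← Abelian.Ext.comp_assoc _ _ _ (add_zero 1)
      (add_zero 0) (by simp)]
    rfl
  -- As `f` and `a ≫ ι_j` have the same connecting class, their difference extends to X₂. The
  -- extension `g` factors through a second stage `k` by `hP`, and the two pieces are added at a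
  -- stage above both.
  obtain ⟨z, hz⟩ := Abelian.Ext.contravariant_sequence_exact₁ hS _
    (Abelian.Ext.mk₀ f + -Abelian.Ext.mk₀ (Y := c.pt) (a ≫ c.ι.app j)) (add_zero 1)
    (by rw [Abelian.Ext.comp_add, Abelian.Ext.comp_neg, hx', add_neg_cancel])
  obtain ⟨g, rfl⟩ := (Abelian.Ext.mk₀_bijective _ _).2 z
  rw [Abelian.Ext.mk₀_comp_mk₀, eq_add_neg_iff_add_eq, ← Abelian.Ext.mk₀_add] at hz
  have hg := (Abelian.Ext.mk₀_bijective _ _).1 hz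
  obtain ⟨k, g', rfl⟩ := hP g
  refine ⟨IsFiltered.max j k, S.f ≫ g' ≫ D.map (IsFiltered.rightToMax j k) +
    a ≫ D.map (IsFiltered.leftToMax j k), ?_⟩
  rw [← hg]
  simp only [Preadditive.add_comp, Category.assoc, Cocone.w]

end Ext

/-! ### Invariance of Ext and of type FP_n under equivalences of categories. -/

section Equivalence

variable {C : Type u} [Category.{v} C] [Abelian C] [HasExt.{v} C] [EnoughInjectives C]
  {D : Type w} [Category.{v} D] [Abelian D] [HasExt.{v} D] (F : C ⥤ D) [F.Additive]
  [F.IsEquivalence]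

/-- An equivalence of categories induces isomorphisms on extension groups. -/
def extFunctorObjIso (X : C) (n : ℕ) :
    Abelian.extFunctorObj X n ≅ F ⋙ Abelian.extFunctorObj (F.obj X) n :=
  -- An equivalence is exact, fully faithful and preserves injectives; with enough injectives in the
  -- source, this yields bijectivity on Ext in every degree.
  NatIso.ofComponents (fun Y ↦ (AddEquiv.ofBijective (F.mapExtAddHom X Y n)
      (F.mapExt_bijective_of_preservesInjectiveObjects X Y n)).toAddCommGrpIso) fun {Y Z} f ↦ by
    refine AddCommGrpCat.hom_ext (AddMonoidHom.ext fun (x : Abelian.Ext X Y n) ↦ ?_)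
    change (x.comp (Abelian.Ext.mk₀ f) (add_zero n)).mapExactFunctor F =
      (x.mapExactFunctor F).comp (Abelian.Ext.mk₀ (F.map f)) (add_zero n)
    rw [Abelian.Ext.mapExactFunctor_comp, Abelian.Ext.mapExactFunctor_mk₀]

lemma subsingleton_ext_map_iff (X Y : C) (n : ℕ) :
    Subsingleton (Abelian.Ext (F.obj X) (F.obj Y) n) ↔ Subsingleton (Abelian.Ext X Y n) :=
  (Equiv.ofBijective _
    (F.mapExt_bijective_of_preservesInjectiveObjects X Y n)).symm.subsingleton_congr

/-- An equivalence of categories induces isomorphisms on the lattices of subobjects. -/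
def subobjectOrderIsoOfEquivalence (X : C) : Subobject X ≃o Subobject (F.obj X) :=
  (Subobject.lowerEquivalence (MonoOver.congr X F.asEquivalence)).toOrderIso

lemma isCompactElement_orderIso {α β : Type*} [PartialOrder α] [PartialOrder β] (e : α ≃o β)
    {k : α} (hk : IsCompactElement k) : IsCompactElement (e k) := by
  intro s u hs hd hu hku
  obtain ⟨x, ⟨y, hy, rfl⟩, hx⟩ := hk (e.symm '' s) (e.symm u) (hs.image _)
    (directedOn_image.2 (hd.mono' fun _ _ _ _ h ↦ e.symm.monotone h)) (e.symm.isLUB_image'.2 hu)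
    (e.le_symm_apply.2 hku)
  exact ⟨y, hy, e.le_symm_apply.1 hx⟩

/-- An equivalence of categories preserves and reflects objects of type `FP_n`. -/
lemma isFP_map_iff (n : ℕ) (X : C) : isFP D n (F.obj X) ↔ isFP C n X := by
  cases n with
  | zero =>
    change IsCompactElement _ ↔ IsCompactElement _
    have e := subobjectOrderIsoOfEquivalence F X
    exact ⟨fun h ↦ by simpa using isCompactElement_orderIso e.symm h,
      fun h ↦ by simpa using isCompactElement_orderIso e h⟩
  | succ n =>
    refine forall₂_congr fun i _ ↦ ⟨fun h ↦ ⟨fun J _ _ ↦ ?_⟩, fun h ↦ ⟨fun J _ _ ↦ ?_⟩⟩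
    · exact preservesColimitsOfShape_of_natIso (extFunctorObjIso F X i).symm
    -- Precomposing the isomorphism with the inverse equivalence expresses Ext(F X, -) as the
    -- inverse followed by Ext(X, -).
    · exact preservesColimitsOfShape_of_natIso
        (Functor.isoWhiskerLeft F.asEquivalence.inverse (extFunctorObjIso F X i) ≪≫
        (Functor.associator _ _ _).symm ≪≫
        Functor.isoWhiskerRight F.asEquivalence.counitIso _ ≪≫ Functor.leftUnitor _)

end Equivalence

/-! ### Morphisms and exact sequences of unital modules -/

section UMod

variable {A : Type u} [NonUnitalRing A]

/-- An additive map commuting with the action of `A` is a morphism of unital modules. -/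
def UMod.homMk {M M' : UMod A} (f : M.obj →+ M'.obj)
    (h : ∀ (a : A) (m : M.obj), f (ZUnit.of a • m) = ZUnit.of a • f m) : M ⟶ M' :=
  ObjectProperty.homMk (Premod.homMk f h)

lemma UMod.hom_ext {M M' : UMod A} {f g : M ⟶ M'} (h : ∀ m : M.obj, f.hom.hom m = g.hom.hom m) :
    f = g :=
  ObjectProperty.hom_ext _ (ModuleCat.hom_ext (LinearMap.ext h))

@[simp] lemma UMod.comp_apply {M M' M'' : UMod A} (f : M ⟶ M') (g : M' ⟶ M'') (m : M.obj) :
    (f ≫ g).hom.hom m = g.hom.hom (f.hom.hom m) := rfl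

@[simp] lemma UMod.zero_apply {M M' : UMod A} (m : M.obj) :
    (0 : M ⟶ M').hom.hom m = 0 := rfl

@[simp] lemma UMod.add_apply {M M' : UMod A} (f g : M ⟶ M') (m : M.obj) :
    (f + g).hom.hom m = f.hom.hom m + g.hom.hom m := rfl

variable [HasEnoughIdempotents A]

/-- Unital modules are closed under subobjects, quotients and finite products among all premodules,
so kernels and cokernels are the usual ones and exactness can be tested on elements. -/
instance : (isUnital A).ι.PreservesHomology where
  preservesKernels _ _ f := (isUnital A).preservesKernels_ι f
  preservesCokernels _ _ f := (isUnital A).preservesCokernels_ι f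

lemma UMod.exists_localUnit (M : UMod A) (m : M.obj) : ∃ a : A, ZUnit.of a • m = m := by
  obtain ⟨I, e, -, he⟩ := exists_family A
  obtain ⟨s, hs⟩ := exists_localUnit_of_mem he (m := m) (by rw [M.property]; trivial)
  exact ⟨_, hs s subset_rfl⟩

lemma UMod.epi_iff_surjective {M M' : UMod A} (f : M ⟶ M') :
    Epi f ↔ Function.Surjective f.hom.hom := by
  rw [← (isUnital A).ι.epi_map_iff_epi f]
  exact ModuleCat.epi_iff_surjective _

lemma UMod.mono_iff_injective {M M' : UMod A} (f : M ⟶ M') :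
    Mono f ↔ Function.Injective f.hom.hom := by
  have := (isUnital A).preservesMonomorphisms_ι_of_isNormalEpiCategory
  rw [← (isUnital A).ι.mono_map_iff_mono f]
  exact ModuleCat.mono_iff_injective _

lemma UMod.exact_iff (S : ShortComplex (UMod A)) :
    S.Exact ↔ ∀ x, S.g.hom.hom x = 0 → ∃ y, S.f.hom.hom y = x := by
  rw [← S.exact_map_iff_of_faithful (isUnital A).ι]
  exact ShortComplex.moduleCat_exact_iff _

lemma UMod.shortExact_iff (S : ShortComplex (UMod A)) :
    S.ShortExact ↔ Function.Injective S.f.hom.hom ∧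
      (∀ x, S.g.hom.hom x = 0 → ∃ y, S.f.hom.hom y = x) ∧ Function.Surjective S.g.hom.hom := by
  rw [← UMod.exact_iff, ← UMod.epi_iff_surjective, ← UMod.mono_iff_injective]
  exact ⟨fun h ↦ ⟨h.mono_f, h.exact, h.epi_g⟩, fun ⟨_, h, _⟩ ↦ .mk' h ‹_› ‹_›⟩

end UMod

/-! ### Characters of abelian groups -/

section Character

lemma exists_character_comp_eq {X Y : Type u} [AddCommGroup X] [AddCommGroup Y] (f : X →+ Y)
    (hf : Function.Injective f) (c : X →+ AddCircle (1 : ℚ)) :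
    ∃ c' : Y →+ AddCircle (1 : ℚ), c'.comp f = c :=
  CharacterModule.dual_surjective_of_injective f.toIntLinearMap hf c

/-- Characters of the middle term of an exact sequence which vanish on the first term come from
the last term. -/
lemma exists_character_comp_eq_of_exact {X Y Z : Type u} [AddCommGroup X] [AddCommGroup Y]
    [AddCommGroup Z] (f : X →+ Y) (g : Y →+ Z) (h : ∀ y, g y = 0 → ∃ x, f x = y)
    (c : Y →+ AddCircle (1 : ℚ)) (hc : c.comp f = 0) :
    ∃ c' : Z →+ AddCircle (1 : ℚ), c'.comp g = c := by
  have hk : g.ker ≤ c.ker := by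
    intro y hy
    obtain ⟨x, rfl⟩ := h y hy
    exact DFunLike.congr_fun hc x
  -- By exactness `c` kills ker g, so it descends to Y/ker g, which embeds in `Z`; injectivity of
  -- ℚ/ℤ extends it.
  obtain ⟨c', hc'⟩ := exists_character_comp_eq (QuotientAddGroup.kerLift g)
    (QuotientAddGroup.kerLift_injective g) (QuotientAddGroup.lift _ c hk)
  exact ⟨c', AddMonoidHom.ext fun y ↦ DFunLike.congr_fun hc' (QuotientAddGroup.mk y)⟩

/-- A complex of abelian groups is exact if its character complex is exact. -/
lemma exact_of_forall_character {X Y Z : Type u} [AddCommGroup X] [AddCommGroup Y]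
    [AddCommGroup Z] (f : X →+ Y) (g : Y →+ Z)
    (h : ∀ c : Y →+ AddCircle (1 : ℚ), c.comp f = 0 → ∃ c' : Z →+ AddCircle (1 : ℚ), c'.comp g = c)
    (y : Y) (hy : g y = 0) : ∃ x, f x = y := by
  by_contra hn
  have h0 : (QuotientAddGroup.mk y : Y ⧸ f.range) ≠ 0 := fun h0 ↦
    hn ((QuotientAddGroup.eq_zero_iff y).1 h0)
  -- If `y` is not in the image of `f`, some character of Y/im f is nonzero on it. Pulled back to
  -- `Y` it kills `f`, hence factors through `g`, contradicting g y = 0.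
  obtain ⟨c, hc⟩ := CharacterModule.exists_character_apply_ne_zero_of_ne_zero h0
  obtain ⟨c', hc'⟩ := h (AddMonoidHom.comp c (QuotientAddGroup.mk' f.range))
    (AddMonoidHom.ext fun x ↦ by
      have : (QuotientAddGroup.mk (f x) : Y ⧸ f.range) = 0 :=
        (QuotientAddGroup.eq_zero_iff _).2 ⟨x, rfl⟩
      exact (congrArg c this).trans (map_zero c))
  apply hc
  have := DFunLike.congr_fun hc' y
  simp only [AddMonoidHom.comp_apply, hy, map_zero] at this
  exact this.symm

end Character

/-! ### The duality between left and right modules -/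

section Duality

variable {A B : Type u} [NonUnitalRing A] [NonUnitalRing B] [HasEnoughIdempotents B]

/-- The character module of an `A`-module, as a module over a ring `B` with a homomorphism to
`Aᵐᵒᵖ`. -/
def charMod (φ : B →ₙ+* Aᵐᵒᵖ) (M : UMod A) : UMod B :=
  unitalPart (Premod.mk (M.obj →+ AddCircle (1 : ℚ)) (charAction φ M.obj))

variable (φ : B →ₙ+* Aᵐᵒᵖ)

/-- The character underlying an element of the character module. -/
def charEval (M : UMod A) : (charMod φ M).obj →+ (M.obj →+ AddCircle (1 : ℚ)) :=
  (smulPart B (Premod.mk (M.obj →+ AddCircle (1 : ℚ)) (charAction φ M.obj))).subtype.toAddMonoidHom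

variable {φ}

lemma charMod_ext {M : UMod A} {x y : (charMod φ M).obj}
    (h : ∀ m, charEval φ M x m = charEval φ M y m) : x = y :=
  Subtype.val_injective (AddMonoidHom.ext h : charEval φ M x = charEval φ M y)

lemma charEval_smul {M : UMod A} (b : B) (x : (charMod φ M).obj) (m : M.obj) :
    charEval φ M (ZUnit.of b • x) m = charEval φ M x (ZUnit.of (φ b).unop • m) :=
  congrArg (fun f : M.obj →+ AddCircle (1 : ℚ) ↦ f m)
    (Premod.mk_smul _ (charAction φ M.obj) b (charEval φ M x))

/-- An arbitrary character of `M` need not lie in the unital part, but its multiple by any `b` does.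
With `b` a local unit, this replaces a character by one in `M⁺` without changing the values that
matter. -/
lemma exists_charEval_eq_smul {M : UMod A} (f : M.obj →+ AddCircle (1 : ℚ)) (b : B) :
    ∃ x, ∀ m, charEval φ M x m = f (ZUnit.of (φ b).unop • m) := by
  have h := smul_mem_smulPart (A := B)
    (M := Premod.mk (M.obj →+ AddCircle (1 : ℚ)) (charAction φ M.obj)) b f
  rw [Premod.mk_smul] at h
  exact ⟨⟨_, h⟩, fun m ↦ rfl⟩

/-- A local unit of `n` also fixes `p n`, by balancedness; so the image of a unital module
automatically lies in the unital part. -/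
lemma pairing_mem_smulPart {M : UMod A} {N : UMod B}
    (p : N.obj →+ (M.obj →+ AddCircle (1 : ℚ)))
    (hp : ∀ b n m, p (ZUnit.of b • n) m = p n (ZUnit.of (φ b).unop • m)) (n : N.obj) :
    p n ∈ smulPart B (Premod.mk (M.obj →+ AddCircle (1 : ℚ)) (charAction φ M.obj)) := by
  obtain ⟨b, hb⟩ := UMod.exists_localUnit N n
  have h := smul_mem_smulPart (A := B)
    (M := Premod.mk (M.obj →+ AddCircle (1 : ℚ)) (charAction φ M.obj)) b (p n)
  rw [Premod.mk_smul] at h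
  have e : charAction φ M.obj b (p n) = p n := AddMonoidHom.ext fun m ↦ by
    conv_rhs => rw [← hb, hp]
    rfl
  rwa [e] at h

/-- A morphism to the character module, given by a balanced pairing. -/
def charLift {M : UMod A} {N : UMod B} (p : N.obj →+ (M.obj →+ AddCircle (1 : ℚ)))
    (hp : ∀ b n m, p (ZUnit.of b • n) m = p n (ZUnit.of (φ b).unop • m)) : N ⟶ charMod φ M :=
  UMod.homMk
    { toFun n := ⟨p n, pairing_mem_smulPart p hp n⟩
      map_zero' := Subtype.ext (map_zero p)
      map_add' x y := Subtype.ext (map_add p x y) }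
    fun b n ↦ charMod_ext fun m ↦ (hp b n m).trans
      (charEval_smul (φ := φ) (M := M) b ⟨p n, pairing_mem_smulPart p hp n⟩ m).symm

/-- The transpose of a morphism of unital modules. -/
def charMap {M M' : UMod A} (f : M ⟶ M') : charMod φ M' ⟶ charMod φ M :=
  charLift ((AddMonoidHom.compHom' f.hom.hom.toAddMonoidHom).comp (charEval φ M'))
    fun b n m ↦ by simp [charEval_smul]

@[simp] lemma charEval_charMap {M M' : UMod A} (f : M ⟶ M') (x : (charMod φ M').obj) (m : M.obj) :
    charEval φ M ((charMap f).hom.hom x) m = charEval φ M' x (f.hom.hom m) := rfl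

lemma charMap_zero {M M' : UMod A} : charMap (φ := φ) (0 : M ⟶ M') = 0 :=
  UMod.hom_ext fun x ↦ charMod_ext fun m ↦ by simp

lemma charMap_comp {M M' M'' : UMod A} (f : M ⟶ M') (g : M' ⟶ M'') :
    charMap (φ := φ) (f ≫ g) = charMap g ≫ charMap f :=
  UMod.hom_ext fun x ↦ charMod_ext fun m ↦ by simp

/-- The character modules of the terms of a short complex. -/
def charComplex [HasEnoughIdempotents A] (φ : B →ₙ+* Aᵐᵒᵖ) (S : ShortComplex (UMod A)) :
    ShortComplex (UMod B) :=
  .mk (charMap (φ := φ) S.g) (charMap S.f) (by rw [← charMap_comp, S.zero, charMap_zero])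

/-- Injectivity of ℚ/ℤ extends the character to `M'`, possibly outside the unital part. Multiplying
by a local unit `b` of `x` brings it back, and the restriction to `M` is still b x = x. -/
lemma charMap_surjective_of_injective {M M' : UMod A} (f : M ⟶ M')
    (hf : Function.Injective f.hom.hom) :
    Function.Surjective (charMap (φ := φ) f).hom.hom := by
  intro x
  obtain ⟨b, hb⟩ := UMod.exists_localUnit _ x
  obtain ⟨c, hc⟩ := exists_character_comp_eq f.hom.hom.toAddMonoidHom hf (charEval φ M x)
  obtain ⟨y, hy⟩ := exists_charEval_eq_smul (φ := φ) c b
  refine ⟨y, charMod_ext fun m ↦ ?_⟩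
  rw [charEval_charMap, hy, ← map_smul, ← hb, charEval_smul]
  exact DFunLike.congr_fun hc _

/-- Taking character modules preserves short exact sequences. -/
lemma charComplex_shortExact [HasEnoughIdempotents A] {S : ShortComplex (UMod A)}
    (hS : S.ShortExact) : (charComplex φ S).ShortExact := by
  obtain ⟨h1, h2, h3⟩ := (UMod.shortExact_iff S).1 hS
  refine (UMod.shortExact_iff _).2 ⟨fun x y hxy ↦ charMod_ext fun m ↦ ?_,
    fun (x : (charMod φ S.X₂).obj) hx ↦ ?_, charMap_surjective_of_injective _ h1⟩
  · obtain ⟨m, rfl⟩ := h3 m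
    exact DFunLike.congr_fun (congrArg (charEval φ _) hxy) m
  · obtain ⟨c, hc⟩ := exists_character_comp_eq_of_exact S.f.hom.hom.toAddMonoidHom
      S.g.hom.hom.toAddMonoidHom h2 (charEval φ _ x) (AddMonoidHom.ext fun m ↦
        DFunLike.congr_fun (congrArg (charEval φ _) hx) m)
    -- The factorization `c` through S.g may fall outside the unital part; a local unit of `x`
    -- corrects it.
    obtain ⟨b, hb⟩ := UMod.exists_localUnit _ x
    obtain ⟨y, hy⟩ := exists_charEval_eq_smul (φ := φ) c b
    refine ⟨y, charMod_ext fun m ↦ (hy _).trans ?_⟩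
    conv_rhs => rw [← hb, charEval_smul]
    refine (congrArg c (map_smul S.g.hom.hom _ m).symm).trans ?_
    exact DFunLike.congr_fun hc _

variable [HasEnoughIdempotents A] {ψ : A →ₙ+* Bᵐᵒᵖ}

/-- The transpose `N ⟶ M⁺` of a morphism `M ⟶ N⁺`. -/
def charFlip (h : ∀ b, ψ (φ b).unop = MulOpposite.op b) {M : UMod A} {N : UMod B}
    (f : M ⟶ charMod ψ N) : N ⟶ charMod φ M :=
  charLift ((charEval ψ N).comp f.hom.hom.toAddMonoidHom).flip
    fun b n m ↦ by simp [charEval_smul, h]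

-- These conditions say that `φ` and `ψ` are mutually inverse up to the identification of a ring
-- with its double opposite. Keeping both homomorphisms as parameters treats left-to-right and
-- right-to-left characters at once.
variable (h : ∀ b, ψ (φ b).unop = MulOpposite.op b) (h' : ∀ a, φ (ψ a).unop = MulOpposite.op a)

lemma charFlip_charFlip {M : UMod A} {N : UMod B} (f : M ⟶ charMod ψ N) :
    charFlip h' (charFlip h f) = f := rfl

lemma charFlip_comp {M M' : UMod A} {N : UMod B} (g : M' ⟶ M) (f : M ⟶ charMod ψ N) :
    charFlip h (g ≫ f) = charFlip h f ≫ charMap g := rfl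

lemma charFlip_comp_charMap {M : UMod A} {N N' : UMod B} (g : N' ⟶ N) (f : M ⟶ charMod ψ N) :
    charFlip h (f ≫ charMap g) = g ≫ charFlip h f := rfl

include h h' in
/-- The character module of a projective module is injective. -/
lemma injective_charMod (P : UMod A) [Projective P] : Injective (charMod φ P) where
  factors {X Y} g f hf := by
    -- Extending X ⟶ P⁺ along X ⟶ Y is, after exchanging the sides of the pairings, lifting P ⟶ X⁺
    -- along the epimorphism Y⁺ ⟶ X⁺.
    have : Epi (charMap (φ := ψ) f) := (UMod.epi_iff_surjective _).2
      (charMap_surjective_of_injective f ((UMod.mono_iff_injective f).1 hf))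
    refine ⟨charFlip h (Projective.factorThru (charFlip h' g) (charMap f)), ?_⟩
    rw [← charFlip_comp_charMap, Projective.factorThru_comp, charFlip_charFlip]

include h h' in
/-- `Ext^1(M, N⁺)` vanishes iff `Ext^1(N, M⁺)` vanishes. -/
lemma subsingleton_ext_charMod_comm (M : UMod A) (N : UMod B) :
    Subsingleton (Abelian.Ext M (charMod ψ N) 1) ↔
      Subsingleton (Abelian.Ext N (charMod φ M) 1) := by
  let S : ShortComplex (UMod A) := .mk (kernel.ι (Projective.π M)) (Projective.π M) (by simp)
  have hS : S.ShortExact := { exact := ShortComplex.exact_kernel _ }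
  have : Projective S.X₂ := Projective.projective_over M
  have : Injective (charComplex φ S).X₂ := injective_charMod h h' S.X₂
  -- For 0 → K → P → M → 0 with `P` projective, the dual sequence 0 → M⁺ → P⁺ → K⁺ → 0 has injective
  -- middle term. Extending K ⟶ N⁺ to `P` is the same problem as lifting N ⟶ K⁺ to P⁺.
  have e1 := subsingleton_ext_one_iff_of_projective hS (charMod ψ N)
  have e2 := subsingleton_ext_one_iff_of_injective (charComplex_shortExact (φ := φ) hS) N
  refine e1.trans (Iff.trans ⟨fun H f ↦ ?_, fun H f ↦ ?_⟩ e2.symm)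
  · obtain ⟨g, hg⟩ := H (charFlip h' f)
    exact ⟨charFlip h g, (charFlip_comp h S.f g).symm.trans (congrArg _ hg)⟩
  · obtain ⟨g, hg⟩ := H (charFlip h f)
    exact ⟨charFlip h' g, (charFlip_comp_charMap h' S.f g).symm.trans (congrArg _ hg)⟩

end Duality

/-! ### Tor and characters -/

/-- The first extension group in terms of a projective resolution. -/
lemma subsingleton_ext_one_iff_of_resolution {C : Type u} [Category.{v} C] [Abelian C]
    [HasExt.{w} C] {X : C} (R : ProjectiveResolution X) (Y : C) :
    Subsingleton (Abelian.Ext X Y 1) ↔ ∀ f : R.complex.X 1 ⟶ Y, R.complex.d 2 1 ≫ f = 0 →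
      ∃ g : R.complex.X 0 ⟶ Y, R.complex.d 1 0 ≫ g = f := by
  let π : R.complex.X 0 ⟶ X := R.π.f 0
  have : Epi π := inferInstanceAs (Epi (R.π.f 0))
  let S : ShortComplex C := .mk (kernel.ι π) π (by simp)
  have hS : S.ShortExact := { exact := ShortComplex.exact_kernel _ }
  have : Projective S.X₂ := R.projective 0
  -- The map R₁ → ker π is a cokernel of R₂ → R₁, so morphisms from R₁ that kill `d 2 1` are the
  -- morphisms from ker π; the criterion for 0 → ker π → R₀ → X → 0 then applies.
  let p : R.complex.X 1 ⟶ kernel π := kernel.lift π (R.complex.d 1 0) R.complex_d_comp_π_f_zero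
  have hp : p ≫ kernel.ι π = R.complex.d 1 0 := kernel.lift_ι _ _ _
  have : Epi p := (ShortComplex.exact_iff_epi_kernel_lift _).1 R.exact₀
  let T : ShortComplex C := .mk (R.complex.d 2 1) p (by
    rw [← cancel_mono (kernel.ι π), Category.assoc, hp, R.complex.d_comp_d, zero_comp])
  have : Epi T.g := this
  have hT : T.Exact := by
    have h : (ShortComplex.mk (R.complex.d 2 1) (R.complex.d 1 0) (by simp)).Exact := by
      have := R.complex_exactAt_succ 0
      rwa [HomologicalComplex.exactAt_iff' _ 2 1 0 (by simp) (by simp)] at this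
    exact (ShortComplex.exact_iff_of_epi_of_isIso_of_mono
      (S₁ := T) (S₂ := ShortComplex.mk (R.complex.d 2 1) (R.complex.d 1 0) (by simp))
      { τ₁ := 𝟙 _, τ₂ := 𝟙 _, τ₃ := kernel.ι π
        comm₁₂ := (Category.id_comp _).trans (Category.comp_id _).symm
        comm₂₃ := (Category.id_comp _).trans hp.symm }).2 h
  refine (subsingleton_ext_one_iff_of_projective hS Y).trans ⟨fun H f hf ↦ ?_, fun H f ↦ ?_⟩
  · obtain ⟨g, hg⟩ := H (hT.gIsCokernel.desc (CokernelCofork.ofπ f hf))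
    refine ⟨g, ?_⟩
    rw [← hp, Category.assoc]
    exact (congrArg (p ≫ ·) hg).trans (hT.gIsCokernel.fac _ WalkingParallelPair.one)
  · obtain ⟨g, hg⟩ := H (p ≫ f) (by
      have := T.zero
      dsimp [T] at this
      rw [← Category.assoc, this, zero_comp])
    refine ⟨g, ?_⟩
    rw [← cancel_epi p, ← hg, ← hp, Category.assoc]

section

variable {A : Type u} [NonUnitalRing A]

/-- The class of `n ⊗ m` in `N ⊗_A M`, as a biadditive map. -/
def TensorA.tmul (N : UMod Aᵐᵒᵖ) (M : UMod A) : M.obj →+ N.obj →+ TensorA N M :=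
  AddMonoidHom.mk' (fun m ↦ AddMonoidHom.mk' (fun n ↦ QuotientAddGroup.mk (n ⊗ₜ[ℤ] m))
    fun n n' ↦ by rw [TensorProduct.add_tmul]; rfl) fun m m' ↦ AddMonoidHom.ext fun n ↦ by
      simp only [AddMonoidHom.mk'_apply, AddMonoidHom.add_apply, TensorProduct.tmul_add]; rfl

lemma TensorA.tmul_smul {N : UMod Aᵐᵒᵖ} {M : UMod A} (a : A) (m : M.obj) (n : N.obj) :
    TensorA.tmul N M (ZUnit.of a • m) n =
      TensorA.tmul N M m (ZUnit.of (MulOpposite.op a) • n) := by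
  refine (QuotientAddGroup.eq_iff_sub_mem).2 ?_
  rw [← neg_mem_iff, neg_sub]
  exact AddSubgroup.subset_closure ⟨n, a, m, rfl⟩

variable [HasEnoughIdempotents A]

/-- The morphism `M ⟶ N⁺` given by a character of `N ⊗_A M`. -/
def TensorA.charHom {N : UMod Aᵐᵒᵖ} {M : UMod A} (c : TensorA N M →+ AddCircle (1 : ℚ)) :
    M ⟶ N.charOp :=
  charLift (φ := (RingEquiv.opOp A : A →ₙ+* Aᵐᵒᵖᵐᵒᵖ)) ((TensorA.tmul N M).compr₂ c) fun b n m ↦ by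
    simp [TensorA.tmul_smul]

/-- The character of `N ⊗_A M` given by a morphism `M ⟶ N⁺`. -/
lemma TensorA.exists_charHom_eq {N : UMod Aᵐᵒᵖ} {M : UMod A} (f : M ⟶ N.charOp) :
    ∃ c : TensorA N M →+ AddCircle (1 : ℚ), TensorA.charHom c = f := by
  let p : N.obj →+ M.obj →+ AddCircle (1 : ℚ) :=
    ((charEval (RingEquiv.opOp A : A →ₙ+* Aᵐᵒᵖᵐᵒᵖ) N).comp f.hom.hom.toAddMonoidHom).flip
  let q : N.obj ⊗[ℤ] M.obj →+ AddCircle (1 : ℚ) := TensorProduct.liftAddHom p (by simp)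
  have hq (n m) : q (n ⊗ₜ m) = p n m := rfl
  refine ⟨QuotientAddGroup.lift _ q ?_, UMod.hom_ext fun m ↦ charMod_ext
    (φ := (RingEquiv.opOp A : A →ₙ+* Aᵐᵒᵖᵐᵒᵖ)) fun n ↦ rfl⟩
  rw [balancing, AddSubgroup.closure_le]
  rintro _ ⟨n, a, m, rfl⟩
  refine (map_sub q _ _).trans (sub_eq_zero.2 ?_)
  rw [hq, hq]
  exact (charEval_smul (φ := (RingEquiv.opOp A : A →ₙ+* Aᵐᵒᵖᵐᵒᵖ)) a (f.hom.hom m) n).symm.trans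
    (congrArg (fun x ↦ charEval (RingEquiv.opOp A : A →ₙ+* Aᵐᵒᵖᵐᵒᵖ) N x n)
      (map_smul f.hom.hom (ZUnit.of a) m).symm)

lemma TensorA.charHom_injective {N : UMod Aᵐᵒᵖ} {M : UMod A} :
    Function.Injective (TensorA.charHom (N := N) (M := M)) := fun _ _ h ↦
  TensorA.hom_ext fun n m ↦ congrArg (fun f : M ⟶ N.charOp ↦
    charEval (RingEquiv.opOp A : A →ₙ+* Aᵐᵒᵖᵐᵒᵖ) N (f.hom.hom m) n) h

lemma TensorA.charHom_comp_map {N : UMod Aᵐᵒᵖ} {M M' : UMod A} (f : M ⟶ M')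
    (c : TensorA N M' →+ AddCircle (1 : ℚ)) :
    TensorA.charHom (c.comp (TensorA.map N f)) = f ≫ TensorA.charHom c := rfl

lemma TensorA.charHom_zero {N : UMod Aᵐᵒᵖ} {M : UMod A} :
    TensorA.charHom (0 : TensorA N M →+ AddCircle (1 : ℚ)) = 0 := rfl

/-- `Tor_1(N, M)` vanishes iff `Ext^1(M, N⁺)` vanishes. -/
lemma subsingleton_tor_one_iff (N : UMod Aᵐᵒᵖ) (M : UMod A) :
    Subsingleton (tor 1 N M) ↔ Subsingleton (Abelian.Ext M N.charOp 1) := by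
  let R := projectiveResolution M
  let K := ((tensorFunctor N).mapHomologicalComplex _).obj R.complex
  have e : Subsingleton (tor 1 N M) ↔ (K.sc' 2 1 0).Exact := by
    refine AddCommGrpCat.isZero_iff_subsingleton.symm.trans
      ((R.isoLeftDerivedObj (tensorFunctor N) 1).isZero_iff.trans ?_)
    change IsZero (K.homology 1) ↔ _
    rw [← K.exactAt_iff_isZero_homology, K.exactAt_iff' 2 1 0 (by simp) (by simp)]
  rw [e, subsingleton_ext_one_iff_of_resolution R, ShortComplex.ab_exact_iff]
  change (∀ x, TensorA.map N (R.complex.d 1 0) x = 0 → ∃ y, TensorA.map N (R.complex.d 2 1) y = x) ↔ _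
  -- Through `TensorA.charHom`, the character complex of N ⊗ R is Hom(R, N⁺), so the two exactness
  -- conditions are dual to each other.
  refine ⟨fun H f hf ↦ ?_, fun H ↦ exact_of_forall_character _ _ fun c hc ↦ ?_⟩
  · obtain ⟨c, rfl⟩ := TensorA.exists_charHom_eq f
    rw [← TensorA.charHom_comp_map, ← TensorA.charHom_zero] at hf
    obtain ⟨c', rfl⟩ := exists_character_comp_eq_of_exact _ _ H c (TensorA.charHom_injective hf)
    exact ⟨TensorA.charHom c', rfl⟩
  · obtain ⟨g, hg⟩ := H (TensorA.charHom c) (by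
      rw [← TensorA.charHom_comp_map, hc, TensorA.charHom_zero])
    obtain ⟨c', rfl⟩ := TensorA.exists_charHom_eq g
    exact ⟨c', TensorA.charHom_injective hg⟩

/-- `Tor_1(N, M)` vanishes iff `Ext^1(N, M⁺)` vanishes. -/
lemma subsingleton_tor_one_iff' (N : UMod Aᵐᵒᵖ) (M : UMod A) :
    Subsingleton (tor 1 N M) ↔ Subsingleton (Abelian.Ext N M.char 1) :=
  (subsingleton_tor_one_iff N M).trans (subsingleton_ext_charMod_comm
    (φ := .id Aᵐᵒᵖ) (ψ := (RingEquiv.opOp A : A →ₙ+* Aᵐᵒᵖᵐᵒᵖ)) (fun _ ↦ rfl) (fun _ ↦ rfl) M N)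

end

/-! ### Finitely generated projective modules -/

section FiniteType

variable {A : Type u} [NonUnitalRing A]

/-- The unital module `A e` for an idempotent `e`. -/
def UMod.cyclic (e : A) (he : e * e = e) : UMod A where
  obj := ModuleCat.of (ZUnit A) (Submodule.span (ZUnit A) {ZUnit.of e})
  property := by
    refine eq_top_iff.2 ?_
    rintro ⟨x, hx⟩ -
    obtain ⟨r, rfl⟩ := Submodule.mem_span_singleton.1 hx
    have h : (⟨r • ZUnit.of e, hx⟩ : Submodule.span (ZUnit A) {ZUnit.of e}) = r • ZUnit.of e •
        (⟨ZUnit.of e, Submodule.mem_span_singleton_self _⟩ :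
          Submodule.span (ZUnit A) {ZUnit.of e}) :=
      Subtype.ext (by simp [← map_mul, he])
    rw [h]
    exact Submodule.smul_mem _ _ (smul_mem_smulPart _ _)

namespace UMod

/-- The generator `e` of `A e`. -/
def cyclicGen (e : A) (he : e * e = e) : (cyclic e he).obj :=
  (⟨ZUnit.of e, Submodule.mem_span_singleton_self _⟩ : Submodule.span (ZUnit A) {ZUnit.of e})

variable {e : A} {he : e * e = e}

lemma exists_smul_cyclicGen (x : (cyclic e he).obj) : ∃ r : ZUnit A, r • cyclicGen e he = x := by
  obtain ⟨x, hx⟩ := x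
  obtain ⟨r, rfl⟩ := Submodule.mem_span_singleton.1 hx
  exact ⟨r, rfl⟩

variable (he) in
/-- The morphism `A e ⟶ M` given by an element of `M`. -/
def cyclicLift {M : UMod A} (m : M.obj) : cyclic e he ⟶ M :=
  ObjectProperty.homMk (ModuleCat.ofHom ((LinearMap.toSpanSingleton (ZUnit A) M.obj m).comp
    (Submodule.span (ZUnit A) {ZUnit.of e}).subtype))

@[simp] lemma cyclicLift_gen {M : UMod A} (m : M.obj) :
    (cyclicLift he m).hom.hom (cyclicGen e he) = ZUnit.of e • m := rfl

lemma smul_cyclicGen : ZUnit.of e • cyclicGen e he = cyclicGen e he :=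
  Subtype.ext (by
    change ZUnit.of e • ZUnit.of e = ZUnit.of e
    rw [smul_eq_mul, ← map_mul, he])

lemma cyclic_hom_ext {M : UMod A} {f g : cyclic e he ⟶ M}
    (h : f.hom.hom (cyclicGen e he) = g.hom.hom (cyclicGen e he)) : f = g :=
  hom_ext fun x ↦ by
    obtain ⟨r, rfl⟩ := exists_smul_cyclicGen x
    rw [map_smul, map_smul, h]

@[simp] lemma sum_apply {M M' : UMod A} {J : Type*} (s : Finset J) (f : J → (M ⟶ M')) (m : M.obj) :
    (∑ j ∈ s, f j).hom.hom m = ∑ j ∈ s, (f j).hom.hom m :=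
  map_sum (AddMonoidHom.mk' (fun f : M ⟶ M' ↦ f.hom.hom m) fun _ _ ↦ rfl) f s

variable [HasEnoughIdempotents A]

/-- A morphism from Ae is determined by its value on the generator, which is fixed by `e`. Any
preimage `m` of that value will do, since `cyclicLift` sends the generator to e m. -/
instance : Projective (cyclic e he) where
  factors f g _ := by
    obtain ⟨m, hm⟩ := (epi_iff_surjective g).1 inferInstance (f.hom.hom (cyclicGen e he))
    refine ⟨cyclicLift he m, cyclic_hom_ext ?_⟩
    rw [comp_apply, cyclicLift_gen, map_smul, hm, ← map_smul, smul_cyclicGen]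

/-- The underlying additive group of a unital module is finitely generated as a module. -/
def IsFG (M : UMod A) : Prop := ∃ s : Finset M.obj, Submodule.span (ZUnit A) (s : Set M.obj) = ⊤

/-- The module `Q` is a direct summand of a finite direct sum of modules of the form `A e`. -/
def IsFGProjective (Q : UMod A) : Prop :=
  ∃ (J : Type) (_ : Fintype J) (e : J → A) (he : ∀ j, e j * e j = e j)
    (π : ∀ j, Q ⟶ cyclic (e j) (he j)) (ι : ∀ j, cyclic (e j) (he j) ⟶ Q),
    ∑ j, π j ≫ ι j = 𝟙 Q

omit [HasEnoughIdempotents A] in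
lemma IsFGProjective.isFG {Q : UMod A} (h : IsFGProjective Q) : IsFG Q := by
  classical
  obtain ⟨J, _, e, he, π, ι, h⟩ := h
  refine ⟨Finset.univ.image fun j ↦ (ι j).hom.hom (cyclicGen (e j) (he j)),
    eq_top_iff.2 fun x _ ↦ ?_⟩
  have hx : (∑ j, π j ≫ ι j).hom.hom x = x := by rw [h]; rfl
  rw [← hx, sum_apply]
  refine sum_mem fun j _ ↦ ?_
  obtain ⟨r, hr⟩ := exists_smul_cyclicGen ((π j).hom.hom x)
  rw [comp_apply, ← hr, map_smul]
  exact Submodule.smul_mem _ _ (Submodule.subset_span (by simp))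

lemma IsFGProjective.projective {Q : UMod A} (h : IsFGProjective Q) : Projective Q where
  factors f g _ := by
    obtain ⟨J, _, e, he, π, ι, h⟩ := h
    refine ⟨∑ j, π j ≫ Projective.factorThru (ι j ≫ f) g, ?_⟩
    simp only [Preadditive.sum_comp, Category.assoc, Projective.factorThru_comp]
    simp only [← Category.assoc, ← Preadditive.sum_comp, h, Category.id_comp]

/-- Finitely generated modules are quotients of finite direct sums of modules `A e`. -/
lemma IsFG.exists_epi {M : UMod A} (h : IsFG M) :
    ∃ (Q : UMod A) (f : Q ⟶ M), IsFGProjective Q ∧ Epi f := by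
  classical
  obtain ⟨s, hs⟩ := h
  obtain ⟨I, e, h1, he⟩ := exists_family A
  have heM (m : M.obj) := exists_localUnit_of_mem he (m := m) (by rw [M.property]; trivial)
  choose t ht using heM
  have := Abelian.hasFiniteBiproducts (C := UMod A)
  -- One summand A e_i is taken for each generator `m` and each idempotent e_i in a finite set with
  -- m = ∑ e_i m. Indexing by `Fin` brings the index set into `Type`, as `IsFGProjective` asks.
  let σ := Fintype.equivFin (s × s.biUnion t)
  let X (j : Fin (Fintype.card (s × s.biUnion t))) : UMod A :=
    cyclic (e (σ.symm j).2) (h1 (σ.symm j).2)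
  let f : biproduct X ⟶ M := biproduct.desc fun j ↦ cyclicLift (h1 (σ.symm j).2) (σ.symm j).1.1
  refine ⟨biproduct X, f, ⟨_, inferInstance, fun j ↦ e (σ.symm j).2, fun j ↦ h1 (σ.symm j).2,
    biproduct.π X, biproduct.ι X, biproduct.total⟩, (epi_iff_surjective _).2 ?_⟩
  rw [← LinearMap.range_eq_top, eq_top_iff, ← hs, Submodule.span_le]
  intro m hm
  have hm' : m = ∑ i ∈ s.biUnion t, ZUnit.of (e i) • m := by
    conv_lhs => rw [← ht m _ (Finset.subset_biUnion_of_mem t hm)]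
    rw [map_sum, Finset.sum_smul]
  rw [hm']
  refine sum_mem fun i hi ↦ ?_
  refine ⟨(biproduct.ι X (σ (⟨m, hm⟩, ⟨i, hi⟩))).hom.hom (cyclicGen _ _), ?_⟩
  rw [← comp_apply, biproduct.ι_desc, cyclicLift_gen, Equiv.symm_apply_apply]

end UMod

end FiniteType

/-! ### Two directed colimits of modules -/

section DirectedColimit

variable {A : Type u} [NonUnitalRing A] [HasEnoughIdempotents A]

namespace UMod

/-- A submodule of a unital module. -/
def ofSubmodule (M : UMod A) (U : Submodule (ZUnit A) M.obj) : UMod A where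
  obj := ModuleCat.of (ZUnit A) U
  property :=
    have : Mono (ModuleCat.ofHom U.subtype) := (ModuleCat.mono_iff_injective _).2 U.subtype_injective
    (isUnital A).prop_of_mono (ModuleCat.ofHom U.subtype) M.property

/-- A quotient of a unital module. -/
def quotient (M : UMod A) (U : Submodule (ZUnit A) M.obj) : UMod A where
  obj := ModuleCat.of (ZUnit A) (M.obj ⧸ U)
  property :=
    have : Epi (ModuleCat.ofHom U.mkQ) := (ModuleCat.epi_iff_surjective _).2 U.mkQ_surjective
    (isUnital A).prop_of_epi (ModuleCat.ofHom U.mkQ) M.property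

/-- The diagram of the finitely generated submodules of `M`. -/
def spanDiagram (M : UMod A) : Finset M.obj ⥤ UMod A where
  obj s := ofSubmodule M (Submodule.span (ZUnit A) (s : Set M.obj))
  map h := ObjectProperty.homMk (ModuleCat.ofHom (Submodule.inclusion
    (Submodule.span_mono (Finset.coe_subset.2 (leOfHom h)))))
  map_id _ := rfl
  map_comp _ _ := rfl

/-- The inclusions of the finitely generated submodules of `M`. -/
def spanCocone (M : UMod A) : Cocone (spanDiagram M) where
  pt := M
  ι := { app _ := ObjectProperty.homMk (ModuleCat.ofHom (Submodule.span _ _).subtype)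
         naturality _ _ _ := rfl }

/-- The components of a cocone over the diagram of the finitely generated submodules. -/
def spanLeg {M : UMod A} (c : Cocone (spanDiagram M)) (s : Finset M.obj) :
    Submodule.span (ZUnit A) (s : Set M.obj) →ₗ[ZUnit A] c.pt.obj :=
  (c.ι.app s).hom.hom

lemma spanLeg_eq_of_le {M : UMod A} (c : Cocone (spanDiagram M)) {s t : Finset M.obj} (h : s ≤ t)
    (m : M.obj) (hs : m ∈ Submodule.span (ZUnit A) (s : Set M.obj))
    (ht : m ∈ Submodule.span (ZUnit A) (t : Set M.obj)) :
    spanLeg c s ⟨m, hs⟩ = spanLeg c t ⟨m, ht⟩ := by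
  rw [spanLeg, ← c.w (homOfLE h)]
  rfl

omit [HasEnoughIdempotents A] in
lemma mem_span_finset_singleton {M : UMod A} (m : M.obj) :
    m ∈ Submodule.span (ZUnit A) (({m} : Finset M.obj) : Set M.obj) :=
  Submodule.subset_span (by simp)

lemma spanLeg_singleton {M : UMod A} (c : Cocone (spanDiagram M)) (s : Finset M.obj) (m : M.obj)
    (hs : m ∈ Submodule.span (ZUnit A) (s : Set M.obj)) :
    spanLeg c {m} ⟨m, mem_span_finset_singleton m⟩ = spanLeg c s ⟨m, hs⟩ := by
  classical
  rw [spanLeg_eq_of_le c Finset.subset_union_left m _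
      (Submodule.span_mono (Finset.coe_subset.2 Finset.subset_union_right) hs),
    spanLeg_eq_of_le c Finset.subset_union_right m hs]

/-- The morphism from `M` given by a compatible family of morphisms from its finitely generated
submodules. -/
def spanDesc {M : UMod A} (c : Cocone (spanDiagram M)) : M ⟶ c.pt :=
  homMk (AddMonoidHom.mk' (fun m ↦ spanLeg c {m} ⟨m, mem_span_finset_singleton m⟩) fun m m' ↦ by
      classical
      -- Additivity is checked inside the submodule spanned by {m, m'}, which contains both elements
      -- and their sum.
      have h1 : m ∈ Submodule.span (ZUnit A) (({m, m'} : Finset M.obj) : Set M.obj) :=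
        Submodule.subset_span (by simp)
      have h2 : m' ∈ Submodule.span (ZUnit A) (({m, m'} : Finset M.obj) : Set M.obj) :=
        Submodule.subset_span (by simp)
      rw [spanLeg_singleton c _ _ h1, spanLeg_singleton c _ _ h2,
        spanLeg_singleton c _ _ (add_mem h1 h2), ← map_add]
      rfl) fun a m ↦ by
    rw [AddMonoidHom.mk'_apply, ← map_smul]
    exact spanLeg_singleton c _ _ (Submodule.smul_mem _ _ (mem_span_finset_singleton m))

/-- A unital module is the colimit of its finitely generated submodules. -/
def spanCoconeIsColimit (M : UMod A) : IsColimit (spanCocone M) where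
  desc := spanDesc
  fac c s := hom_ext fun m ↦ spanLeg_singleton c s m.1 m.2
  uniq c f hf := hom_ext fun (m : M.obj) ↦ by
    change f.hom.hom m = (c.ι.app {m}).hom.hom _
    rw [← hf]
    rfl

/-- The diagram of the quotients of `Q` by finitely generated submodules of `L`. -/
def quotientDiagram (Q : UMod A) (L : Submodule (ZUnit A) Q.obj) : Finset L ⥤ UMod A where
  obj t := quotient Q (Submodule.span (ZUnit A) (Subtype.val '' (t : Set L)))
  map h := ObjectProperty.homMk (ModuleCat.ofHom (Submodule.factor
    (Submodule.span_mono (Set.image_mono (Finset.coe_subset.2 (leOfHom h))))))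
  map_id _ := hom_ext fun m ↦ by
    obtain ⟨m, rfl⟩ := Submodule.Quotient.mk_surjective _ m
    rfl
  map_comp _ _ := hom_ext fun m ↦ by
    obtain ⟨m, rfl⟩ := Submodule.Quotient.mk_surjective _ m
    rfl

omit [HasEnoughIdempotents A] in
lemma span_image_ker_le {Q K : UMod A} (f : Q ⟶ K) (t : Set (LinearMap.ker f.hom.hom)) :
    Submodule.span (ZUnit A) (Subtype.val '' t) ≤ LinearMap.ker f.hom.hom := by
  rw [Submodule.span_le]
  rintro _ ⟨x, -, rfl⟩
  exact x.2

/-- The projection to a quotient of a unital module. -/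
def quotientπ (M : UMod A) (U : Submodule (ZUnit A) M.obj) : M ⟶ quotient M U :=
  ObjectProperty.homMk (ModuleCat.ofHom U.mkQ)

instance (M : UMod A) (U : Submodule (ZUnit A) M.obj) : Epi (quotientπ M U) :=
  (epi_iff_surjective _).2 U.mkQ_surjective

/-- The morphism from a quotient given by a morphism vanishing on the submodule. -/
def quotientDesc {Q K : UMod A} (f : Q ⟶ K) (U : Submodule (ZUnit A) Q.obj)
    (hU : U ≤ LinearMap.ker f.hom.hom) : quotient Q U ⟶ K :=
  ObjectProperty.homMk (ModuleCat.ofHom (U.liftQ f.hom.hom hU))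

/-- A quotient `K` of `Q` is a cocone over the quotients of `Q` by finitely generated submodules
of the kernel. -/
def quotientCocone {Q K : UMod A} (f : Q ⟶ K) :
    Cocone (quotientDiagram Q (LinearMap.ker f.hom.hom)) where
  pt := K
  ι :=
    { app t := quotientDesc f _ (span_image_ker_le f t)
      naturality _ _ _ := hom_ext fun m ↦ by
        obtain ⟨m, rfl⟩ := Submodule.Quotient.mk_surjective _ m
        rfl }

/-- The composition of a component of a cocone over the quotients of `Q` with the projection. -/
def quotientLeg {Q : UMod A} {L : Submodule (ZUnit A) Q.obj} (c : Cocone (quotientDiagram Q L))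
    (t : Finset L) : Q ⟶ c.pt :=
  quotientπ Q _ ≫ (show quotient Q (Submodule.span (ZUnit A) (Subtype.val '' (t : Set L))) ⟶ c.pt
    from c.ι.app t)

/-- The stage at the empty set is Q/0, so a cocone amounts to a single morphism from `Q`; the stages
at singletons force it to vanish on `L`. -/
lemma quotientLeg_eq {Q : UMod A} {L : Submodule (ZUnit A) Q.obj} (c : Cocone (quotientDiagram Q L))
    (t : Finset L) : quotientLeg c t = quotientLeg c ∅ := by
  have h : (quotientDiagram Q L).map (homOfLE (Finset.empty_subset t)) ≫ c.ι.app t = c.ι.app ∅ :=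
    c.w _
  refine hom_ext fun x ↦ ?_
  change (c.ι.app t).hom.hom (Submodule.Quotient.mk x) =
    (c.ι.app ∅).hom.hom (Submodule.Quotient.mk x)
  rw [← h]
  rfl

lemma quotientLeg_apply_eq_zero {Q : UMod A} {L : Submodule (ZUnit A) Q.obj}
    (c : Cocone (quotientDiagram Q L)) (x : Q.obj) (hx : x ∈ L) :
    (quotientLeg c ∅).hom.hom x = 0 := by
  rw [← quotientLeg_eq c {⟨x, hx⟩}, quotientLeg, comp_apply]
  have h : (quotientπ Q (Submodule.span (ZUnit A) (Subtype.val ''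
      (({⟨x, hx⟩} : Finset L) : Set L)))).hom.hom x = 0 :=
    (Submodule.Quotient.mk_eq_zero _).2 (Submodule.subset_span (by simp))
  rw [h, map_zero]

lemma comp_quotientLeg_eq_zero {Q K : UMod A} (f : Q ⟶ K)
    (c : Cocone (quotientDiagram Q (LinearMap.ker f.hom.hom))) :
    kernel.ι f ≫ quotientLeg c ∅ = 0 := hom_ext fun x ↦ by
  rw [comp_apply, zero_apply]
  refine quotientLeg_apply_eq_zero c _ ?_
  rw [LinearMap.mem_ker, ← comp_apply, kernel.condition, zero_apply]

/-- A quotient `K` of `Q` is the colimit of the quotients of `Q` by finitely generated submodules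
of the kernel. -/
def quotientCoconeIsColimit {Q K : UMod A} (f : Q ⟶ K) [Epi f] :
    IsColimit (quotientCocone f) where
  desc c := Abelian.epiDesc f (quotientLeg c ∅) (comp_quotientLeg_eq_zero f c)
  fac c t := by
    refine (cancel_epi (quotientπ Q _)).1 ?_
    refine Eq.trans ?_ (quotientLeg_eq c t).symm
    exact Abelian.comp_epiDesc f (quotientLeg c ∅) (comp_quotientLeg_eq_zero f c)
  uniq c g hg := by
    refine (cancel_epi f).1 ((Abelian.comp_epiDesc f (quotientLeg c ∅)
      (comp_quotientLeg_eq_zero f c)).trans ?_).symm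
    exact (congrArg (quotientπ Q _ ≫ ·) (hg ∅)).symm

/-- A module is finitely generated if morphisms to the colimit of its finitely generated
submodules factor through a stage. -/
lemma isFG_of_factors {M : UMod A} (h : ∃ (s : Finset M.obj) (g : M ⟶ (spanDiagram M).obj s),
    g ≫ (spanCocone M).ι.app s = 𝟙 M) : IsFG M := by
  obtain ⟨s, g, hg⟩ := h
  refine ⟨s, eq_top_iff.2 fun m _ ↦ ?_⟩
  have : ((g ≫ (spanCocone M).ι.app s).hom.hom m) = m := by rw [hg]; rfl
  rw [← this]
  exact (g.hom.hom m).2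

/-- Morphisms from a finitely generated module to `M` factor through a finitely generated
submodule. -/
lemma IsFG.exists_factor {P M : UMod A} (hP : IsFG P) (g : P ⟶ M) :
    ∃ (s : Finset M.obj) (g' : P ⟶ (spanDiagram M).obj s), g' ≫ (spanCocone M).ι.app s = g := by
  classical
  obtain ⟨t, ht⟩ := hP
  refine ⟨t.image g.hom.hom, ObjectProperty.homMk (ModuleCat.ofHom
    (LinearMap.codRestrict _ g.hom.hom fun x ↦ ?_)), rfl⟩
  have hx : x ∈ Submodule.span (ZUnit A) (t : Set P.obj) := by rw [ht]; trivial
  have := Submodule.mem_map_of_mem (f := g.hom.hom) hx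
  rwa [Submodule.map_span, ← Finset.coe_image] at this

end UMod

end DirectedColimit

/-! ### Modules of type `FP_2` and double character modules -/

section BidualComparison

lemma character_comp_injective_iff {X Y : Type u} [AddCommGroup X] [AddCommGroup Y] (f : X →+ Y) :
    Function.Injective (AddMonoidHom.compHom' (P := AddCircle (1 : ℚ)) f) ↔
      Function.Surjective f :=
  CharacterModule.dual_injective_iff_surjective (f := f.toIntLinearMap)

lemma character_comp_surjective_iff {X Y : Type u} [AddCommGroup X] [AddCommGroup Y] (f : X →+ Y) :
    Function.Surjective (AddMonoidHom.compHom' (P := AddCircle (1 : ℚ)) f) ↔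
      Function.Injective f :=
  CharacterModule.dual_surjective_iff_injective (f := f.toIntLinearMap)

variable {A B : Type u} [NonUnitalRing A] [NonUnitalRing B]
  {φ : B →ₙ+* Aᵐᵒᵖ} {ψ : A →ₙ+* Bᵐᵒᵖ}

/-- The double character group of `Hom(K, M)`. -/
abbrev HomBidual (K M : UMod A) : Type u :=
  ((K ⟶ M) →+ AddCircle (1 : ℚ)) →+ AddCircle (1 : ℚ)

/-- The functoriality of `HomBidual` in the first variable. -/
def HomBidual.map {K K' : UMod A} (f : K' ⟶ K) (M : UMod A) : HomBidual K M →+ HomBidual K' M :=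
  AddMonoidHom.compHom' (AddMonoidHom.compHom' (Preadditive.leftComp M f))

/-- The evaluation of morphisms at an element, as a biadditive map. -/
def UMod.evalHom (K M : UMod A) : K.obj →+ (K ⟶ M) →+ M.obj :=
  AddMonoidHom.mk' (fun k ↦ AddMonoidHom.mk' (fun g ↦ g.hom.hom k) fun _ _ ↦ rfl)
    fun k k' ↦ AddMonoidHom.ext fun g ↦ map_add g.hom.hom k k'

@[simp] lemma UMod.evalHom_apply (K M : UMod A) (k : K.obj) (g : K ⟶ M) :
    UMod.evalHom K M k g = g.hom.hom k := rfl

lemma HomBidual.map_sum {K K' : UMod A} {J : Type*} (s : Finset J) (f : J → (K' ⟶ K)) (M : UMod A)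
    (ξ : HomBidual K M) : HomBidual.map (∑ j ∈ s, f j) M ξ = ∑ j ∈ s, HomBidual.map (f j) M ξ := by
  refine AddMonoidHom.ext fun η ↦ ?_
  rw [AddMonoidHom.finsetSum_apply]
  change ξ (η.comp (Preadditive.leftComp M _)) = ∑ j ∈ s, ξ (η.comp (Preadditive.leftComp M (f j)))
  rw [← _root_.map_sum]
  refine congrArg ξ (AddMonoidHom.ext fun g ↦ ?_)
  simp [Preadditive.leftComp, Preadditive.sum_comp]

variable [HasEnoughIdempotents A] [HasEnoughIdempotents B] (h' : ∀ a, φ (ψ a).unop = MulOpposite.op a)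

/-- The comparison map from the double character group of `Hom(K, M)` to `Hom(K, M⁺⁺)`. -/
def bidualComparison (K M : UMod A) (ξ : HomBidual K M) : K ⟶ charMod ψ (charMod φ M) :=
  charLift (AddMonoidHom.mk' (fun k ↦ ξ.comp
      ((AddMonoidHom.compHom' (UMod.evalHom K M k)).comp (charEval φ M))) fun k k' ↦ by
      ext x
      simp only [AddMonoidHom.comp_apply, AddMonoidHom.add_apply, ← map_add]
      refine congrArg ξ (AddMonoidHom.ext fun g ↦ ?_)
      simp)
    fun a k x ↦ by
      refine congrArg ξ (AddMonoidHom.ext fun g ↦ ?_)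
      simp [charEval_smul, h']

lemma bidualComparison_apply (K M : UMod A) (ξ : HomBidual K M) (k : K.obj)
    (x : (charMod φ M).obj) :
    charEval ψ _ ((bidualComparison h' K M ξ).hom.hom k) x =
      ξ ((charEval φ M x).comp (UMod.evalHom K M k)) := rfl

lemma bidualComparison_add (K M : UMod A) (ξ ξ' : HomBidual K M) :
    bidualComparison h' K M (ξ + ξ') = bidualComparison h' K M ξ + bidualComparison h' K M ξ' :=
  rfl

lemma bidualComparison_map {K K' : UMod A} (f : K' ⟶ K) (M : UMod A) (ξ : HomBidual K M) :
    bidualComparison h' K' M (HomBidual.map f M ξ) = f ≫ bidualComparison h' K M ξ := rfl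

/-- The comparison map is additive. -/
def bidualComparisonHom (K M : UMod A) : HomBidual K M →+ (K ⟶ charMod ψ (charMod φ M)) :=
  AddMonoidHom.mk' (bidualComparison h' K M) (bidualComparison_add h' K M)

/-- Evaluation at the generator identifies Hom(Ae, M) with eM, and both sides become the double
character group of eM. -/
lemma bidualComparison_bijective_cyclic {e : A} (he : e * e = e) (M : UMod A) :
    Function.Bijective (bidualComparison h' (UMod.cyclic e he) M) := by
  let ε : M.obj →+ (UMod.cyclic e he ⟶ M) :=
    AddMonoidHom.mk' (UMod.cyclicLift he) fun m m' ↦ UMod.cyclic_hom_ext (by simp)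
  have hε (g : UMod.cyclic e he ⟶ M) : ε (g.hom.hom (UMod.cyclicGen e he)) = g :=
    UMod.cyclic_hom_ext (by
      change ZUnit.of e • g.hom.hom (UMod.cyclicGen e he) = g.hom.hom (UMod.cyclicGen e he)
      rw [← map_smul, UMod.smul_cyclicGen])
  -- Every character `η` of Hom(Ae, M) is given by an element of M⁺: η ∘ ε is unchanged by the
  -- action of `e`, hence lies in the unital part.
  have hx (η : (UMod.cyclic e he ⟶ M) →+ AddCircle (1 : ℚ)) :
      ∃ x, charEval φ M x = η.comp ε := by
    obtain ⟨x, hx⟩ := exists_charEval_eq_smul (φ := φ) (η.comp ε) (ψ e).unop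
    refine ⟨x, AddMonoidHom.ext fun m ↦ (hx m).trans (congrArg η ?_)⟩
    rw [h']
    refine UMod.cyclic_hom_ext ?_
    change ZUnit.of e • ZUnit.of e • m = ZUnit.of e • m
    rw [← mul_smul, ← map_mul, he]
  constructor
  · refine (injective_iff_map_eq_zero (bidualComparisonHom h' (UMod.cyclic e he) M)).2 fun ξ hξ ↦ ?_
    refine AddMonoidHom.ext fun η ↦ ?_
    obtain ⟨x, hx⟩ := hx η
    have : ξ ((charEval φ M x).comp (UMod.evalHom _ M (UMod.cyclicGen e he))) = 0 :=
      congrArg (fun f : UMod.cyclic e he ⟶ charMod ψ (charMod φ M) ↦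
        charEval ψ _ (f.hom.hom (UMod.cyclicGen e he)) x) hξ
    rw [hx] at this
    rw [AddMonoidHom.zero_apply, ← this]
    exact congrArg ξ (AddMonoidHom.ext fun g ↦ congrArg η (hε g).symm)
  · intro f
    choose x hx using hx
    -- The preimage of `f` sends `η` to the value of `y` at the element of M⁺ representing `η`. This
    -- suffices because e y = y: only the e-component of an element of M⁺ matters.
    let X : ((UMod.cyclic e he ⟶ M) →+ AddCircle (1 : ℚ)) →+ (charMod φ M).obj :=
      AddMonoidHom.mk' x fun η η' ↦ charMod_ext fun m ↦ by
        rw [map_add, AddMonoidHom.add_apply, hx, hx, hx]; rfl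
    let y := f.hom.hom (UMod.cyclicGen e he)
    refine ⟨(charEval ψ (charMod φ M) y).comp X, UMod.cyclic_hom_ext (charMod_ext fun z ↦ ?_)⟩
    rw [bidualComparison_apply]
    have hy : ZUnit.of e • y = y := by rw [← map_smul, UMod.smul_cyclicGen]
    change _ = charEval ψ (charMod φ M) y z
    conv_rhs => rw [← hy, charEval_smul]
    refine congrArg (charEval ψ (charMod φ M) y) (charMod_ext fun m ↦ ?_)
    rw [charEval_smul, h']
    exact DFunLike.congr_fun (hx _) m

/-- The comparison is additive and natural in `K`, so bijectivity passes to direct summands of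
finite sums. The case of a single index gives closure under retracts. -/
lemma bidualComparison_bijective_of_sum {J : Type*} [Fintype J] {Q : UMod A} {X : J → UMod A}
    (π : ∀ j, Q ⟶ X j) (ι : ∀ j, X j ⟶ Q) (h : ∑ j, π j ≫ ι j = 𝟙 Q) (M : UMod A)
    (hX : ∀ j, Function.Bijective (bidualComparison h' (X j) M)) :
    Function.Bijective (bidualComparison h' Q M) := by
  constructor
  · refine (injective_iff_map_eq_zero (bidualComparisonHom h' Q M)).2 fun ξ hξ ↦ ?_
    have h0 (j : J) : HomBidual.map (ι j) M ξ = 0 := by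
      refine (injective_iff_map_eq_zero (bidualComparisonHom h' (X j) M)).1 (hX j).1 _ ?_
      exact (bidualComparison_map h' (ι j) M ξ).trans ((congrArg (ι j ≫ ·) hξ).trans comp_zero)
    have h1 : HomBidual.map (𝟙 Q) M ξ = ξ := by
      refine AddMonoidHom.ext fun η ↦ congrArg ξ (AddMonoidHom.ext fun g ↦ congrArg η ?_)
      change 𝟙 Q ≫ g = g
      rw [Category.id_comp]
    rw [← h1, ← h, HomBidual.map_sum]
    refine Finset.sum_eq_zero fun j _ ↦ ?_
    have : HomBidual.map (π j ≫ ι j) M ξ = HomBidual.map (π j) M (HomBidual.map (ι j) M ξ) := by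
      refine AddMonoidHom.ext fun η ↦ congrArg ξ (AddMonoidHom.ext fun g ↦ congrArg η ?_)
      change (π j ≫ ι j) ≫ g = π j ≫ ι j ≫ g
      rw [Category.assoc]
    rw [this, h0, map_zero]
  · intro f
    choose ξ hξ using fun j ↦ (hX j).2 (ι j ≫ f)
    refine ⟨∑ j, HomBidual.map (π j) M (ξ j), ?_⟩
    refine (map_sum (bidualComparisonHom h' Q M) _ _).trans ?_
    have (j : J) : bidualComparisonHom h' Q M (HomBidual.map (π j) M (ξ j)) = (π j ≫ ι j) ≫ f :=
      (bidualComparison_map h' (π j) M (ξ j)).trans (by rw [hξ, Category.assoc])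
    simp only [this, ← Preadditive.sum_comp, h, Category.id_comp]

lemma bidualComparison_bijective_of_isFGProjective {Q : UMod A} (hQ : Q.IsFGProjective)
    (M : UMod A) : Function.Bijective (bidualComparison h' Q M) := by
  obtain ⟨J, _, e, he, π, ι, h⟩ := hQ
  exact bidualComparison_bijective_of_sum h' π ι h M
    fun j ↦ bidualComparison_bijective_cyclic h' (he j) M

/-- A diagram chase: Hom(-, M) turns X₁ → X₂ → X₃ → 0 into a left exact sequence, double characters
keep it exact, and Hom(-, M⁺⁺) is left exact as well. -/
lemma bidualComparison_bijective_of_exact {S : ShortComplex (UMod A)} (hS : S.Exact) [Epi S.g]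
    (M : UMod A) (h1 : Function.Bijective (bidualComparison h' S.X₁ M))
    (h2 : Function.Bijective (bidualComparison h' S.X₂ M)) :
    Function.Bijective (bidualComparison h' S.X₃ M) := by
  have hinj : Function.Injective (HomBidual.map S.g M) := by
    refine (injective_iff_map_eq_zero _).2 fun ξ hξ ↦ AddMonoidHom.ext fun η ↦ ?_
    obtain ⟨η', rfl⟩ := exists_character_comp_eq (Preadditive.leftComp M S.g)
      (fun a b hab ↦ (cancel_epi S.g).1 hab) η
    exact DFunLike.congr_fun hξ η'
  constructor
  · intro ξ ξ' h
    refine hinj (h2.1 ?_)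
    rw [bidualComparison_map, bidualComparison_map, h]
  · intro f
    obtain ⟨ζ, hζ⟩ := h2.2 (S.g ≫ f)
    have h0 : HomBidual.map S.f M ζ = 0 := by
      refine (injective_iff_map_eq_zero (bidualComparisonHom h' S.X₁ M)).1 h1.1 _ ?_
      refine (bidualComparison_map h' S.f M ζ).trans ?_
      rw [hζ, S.zero_assoc, zero_comp]
    obtain ⟨ξ, hξ⟩ := exists_character_comp_eq_of_exact
      (AddMonoidHom.compHom' (P := AddCircle (1 : ℚ)) (Preadditive.leftComp M S.f))
      (AddMonoidHom.compHom' (P := AddCircle (1 : ℚ)) (Preadditive.leftComp M S.g))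
      (fun η hη ↦ exists_character_comp_eq_of_exact (Preadditive.leftComp M S.g)
        (Preadditive.leftComp M S.f) (fun g hg ↦ ⟨hS.gIsCokernel.desc (CokernelCofork.ofπ g hg),
          hS.gIsCokernel.fac _ WalkingParallelPair.one⟩) η hη) ζ h0
    refine ⟨ξ, (cancel_epi S.g).1 ?_⟩
    rw [← bidualComparison_map, ← hζ]
    exact congrArg _ hξ

lemma bidualComparison_bijective_quotient {Q : UMod A} (hQ : Q.IsFGProjective)
    {U : Submodule (ZUnit A) Q.obj} (hU : U.FG) (M : UMod A) :
    Function.Bijective (bidualComparison h' (Q.quotient U) M) := by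
  obtain ⟨P, p, hP, hp⟩ := UMod.IsFG.exists_epi (M := Q.ofSubmodule U)
    (Module.finite_def.1 (Module.Finite.iff_fg.2 hU))
  let i : Q.ofSubmodule U ⟶ Q := ObjectProperty.homMk (ModuleCat.ofHom U.subtype)
  let S : ShortComplex (UMod A) := .mk (p ≫ i) (UMod.quotientπ Q U) (UMod.hom_ext fun x ↦
    (Submodule.Quotient.mk_eq_zero _).2 (p.hom.hom x).2)
  have hS : S.Exact := (UMod.exact_iff S).2 fun x hx ↦ by
    obtain ⟨y, hy⟩ := (UMod.epi_iff_surjective p).1 hp ⟨x, (Submodule.Quotient.mk_eq_zero _).1 hx⟩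
    exact ⟨y, congrArg Subtype.val hy⟩
  have : Epi S.g := inferInstanceAs (Epi (UMod.quotientπ Q U))
  exact bidualComparison_bijective_of_exact h' hS M
    (bidualComparison_bijective_of_isFGProjective h' hP M)
    (bidualComparison_bijective_of_isFGProjective h' hQ M)

include h' in
/-- Objects of type `FP_2` have presentations by modules for which the comparison map is
bijective. -/
lemma exists_shortExact_of_isFP {n : ℕ} (hn : 2 ≤ n) {F : UMod A} (hF : isFP (UMod A) n F)
    (M : UMod A) : ∃ S : ShortComplex (UMod A), S.ShortExact ∧ S.X₃ = F ∧ Projective S.X₂ ∧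
      Function.Bijective (bidualComparison h' S.X₁ M) ∧
      Function.Bijective (bidualComparison h' S.X₂ M) := by
  obtain ⟨n, rfl⟩ := Nat.exists_eq_add_of_le' hn
  have h0 : PreservesFilteredColimits (Abelian.extFunctorObj F 0) := hF 0 (by lia)
  have h1 : PreservesFilteredColimits (Abelian.extFunctorObj F 1) := hF 1 (by lia)
  have hfg : F.IsFG := by
    -- Since Hom(F, -) = Ext^0(F, -) preserves the union of the finitely generated submodules of
    -- `F`, the identity factors through one of them.
    obtain ⟨s, x, hx⟩ := Concrete.isColimit_exists_rep _
      (isColimitOfPreserves (Abelian.extFunctorObj F 0) (UMod.spanCoconeIsColimit F))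
      (Abelian.Ext.mk₀ (𝟙 F))
    obtain ⟨g, rfl⟩ := (Abelian.Ext.mk₀_bijective _ _).2 (x : Abelian.Ext F _ 0)
    refine UMod.isFG_of_factors ⟨s, g, (Abelian.Ext.mk₀_bijective _ _).1 ?_⟩
    exact (Abelian.Ext.mk₀_comp_mk₀ g ((UMod.spanCocone F).ι.app s)).symm.trans hx
  obtain ⟨P, f, hP, _⟩ := hfg.exists_epi
  let S : ShortComplex (UMod A) := .mk (kernel.ι f) f (by simp)
  have hS : S.ShortExact := { exact := ShortComplex.exact_kernel _ }
  have hP' : Projective S.X₂ := hP.projective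
  have : PreservesFilteredColimits (Abelian.extFunctorObj S.X₃ 1) := h1
  -- The same argument for the kernel, one degree higher: preservation by Ext^1(F, -) makes the
  -- identity of the kernel factor through a finitely generated submodule.
  have hKfg : S.X₁.IsFG := by
    refine UMod.isFG_of_factors (exists_factor_of_preservesColimit_ext hS
      (UMod.spanCoconeIsColimit S.X₁) (fun g ↦ ?_) (𝟙 S.X₁))
    exact hP.isFG.exists_factor g
  obtain ⟨Q, q, hQ, _⟩ := hKfg.exists_epi
  have := hQ.projective
  -- The kernel is the colimit of the quotients of `Q` by finitely generated submodules of ker q, so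
  -- it is a retract of one of them. Morphisms from the projective X₂ lift to `Q`, hence factor
  -- through the stage ∅.
  obtain ⟨t, s, hs⟩ := exists_factor_of_preservesColimit_ext hS
    (UMod.quotientCoconeIsColimit q) (fun g ↦ by
      refine ⟨∅, Projective.factorThru (show S.X₂ ⟶ S.X₁ from g) q ≫ UMod.quotientπ Q _, ?_⟩
      exact Projective.factorThru_comp (show S.X₂ ⟶ S.X₁ from g) q) (𝟙 S.X₁)
  refine ⟨S, hS, rfl, hP', ?_, bidualComparison_bijective_of_isFGProjective h' hP M⟩
  refine bidualComparison_bijective_of_sum (J := Unit) h' (fun _ ↦ s)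
    (fun _ ↦ (UMod.quotientCocone q).ι.app t) (by
      rw [Fintype.sum_unique]; exact hs) M fun _ ↦ ?_
  exact bidualComparison_bijective_quotient h' hQ (Submodule.fg_span (t.finite_toSet.image _)) M

include h' in
/-- For modules `F` of type `FP_2`, the first extension groups with values in a module and in its
double character module vanish simultaneously. -/
lemma subsingleton_ext_bidual_iff {n : ℕ} (hn : 2 ≤ n) {F : UMod A} (hF : isFP (UMod A) n F)
    (M : UMod A) : Subsingleton (Abelian.Ext F (charMod ψ (charMod φ M)) 1) ↔
      Subsingleton (Abelian.Ext F M 1) := by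
  obtain ⟨S, hS, rfl, _, b1, b2⟩ := exists_shortExact_of_isFP h' hn hF M
  rw [subsingleton_ext_one_iff_of_projective hS, subsingleton_ext_one_iff_of_projective hS]
  -- Dualizing twice preserves and reflects surjectivity, and on double duals the comparison map
  -- carries the problem for `M` to the one for M⁺⁺.
  have e : Function.Surjective (Preadditive.leftComp M S.f) ↔
      Function.Surjective (HomBidual.map S.f M) := by
    exact (character_comp_injective_iff _).symm.trans (character_comp_surjective_iff _).symm
  change _ ↔ Function.Surjective (Preadditive.leftComp M S.f)
  rw [e]
  refine ⟨fun H ξ ↦ ?_, fun H f ↦ ?_⟩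
  · obtain ⟨g, hg⟩ := H (bidualComparison h' _ M ξ)
    obtain ⟨ζ, rfl⟩ := b2.2 g
    exact ⟨ζ, b1.1 hg⟩
  · obtain ⟨ξ, rfl⟩ := b1.2 f
    obtain ⟨ζ, rfl⟩ := H ξ
    exact ⟨bidualComparison h' _ M ζ, rfl⟩

end BidualComparison

/-! ### The functor `Θ` is an equivalence -/

section ThetaEquivalence

variable {G : Type u} [Category.{v} G] [Preadditive G] {I : Type v} {P : I → G}

namespace HomSum

lemma single_injective {i : I} {X : G} :
    Function.Injective (single : (P i ⟶ X) →+ HomSum P X) := by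
  classical
  exact DirectSum.of_injective (β := fun i ↦ (P i ⟶ X)) i

lemma single_apply {i : I} {X : G} (f : P i ⟶ X) : (single f : HomSum P X) i = f := by
  classical
  exact DirectSum.of_eq_same (β := fun i ↦ (P i ⟶ X)) i f

lemma single_apply_of_ne {i j : I} {X : G} (f : P i ⟶ X) (h : j ≠ i) :
    (single f : HomSum P X) j = 0 := by
  classical
  exact DirectSum.of_eq_of_ne (β := fun i ↦ (P i ⟶ X)) _ _ _ h

lemma act_ofHom_single {X : G} {i j : I} (g : P i ⟶ P j) (f : P j ⟶ X) :
    act (IndRing.ofHom g) (single f) = single (g ≫ f) := by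
  simp [IndRing.ofHom]

lemma act_ofHom_single_of_ne {X : G} {i j k : I} (g : P i ⟶ P j) (f : P k ⟶ X) (h : k ≠ j) :
    act (IndRing.ofHom g) (single f) = 0 := by
  simp [IndRing.ofHom, IndRing.row_ofRow_of_ne _ h]

lemma act_id {X : G} (i : I) (x : HomSum P X) : act (IndRing.ofHom (𝟙 (P i))) x = single (x i) := by
  induction x using HomSum.induction with
  | zero => exact (_root_.map_zero _).trans (_root_.map_zero single).symm
  | single j f =>
    by_cases h : j = i
    · subst h
      rw [act_ofHom_single, single_apply, Category.id_comp]
    · rw [act_ofHom_single_of_ne _ _ h, single_apply_of_ne _ (Ne.symm h), _root_.map_zero]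
  | add x y hx hy => rw [_root_.map_add, hx, hy, ← _root_.map_add]; rfl

/-- An additive map which vanishes on the components of an element vanishes on the element. -/
lemma map_eq_zero_of_forall {X : G} {T : Type*} [AddCommGroup T] (q : HomSum P X →+ T)
    (x : HomSum P X) (h : ∀ i, q (single (x i)) = 0) : q x = 0 := by
  classical
  rw [← DirectSum.sum_support_of x, map_sum]
  exact Finset.sum_eq_zero fun i _ ↦ h i

end HomSum

lemma theta_smul {X : G} (a : IndRing P) (x : HomSum P X) :
    (ZUnit.of (MulOpposite.op a) • (show ((theta P).obj X).obj from x) : ((theta P).obj X).obj) =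
      HomSum.act a x :=
  Premod.mk_smul _ (thetaAction P X) (MulOpposite.op a) x

lemma smul_ofHom_smul {M : UMod (IndRing P)ᵐᵒᵖ} {i j k : I} (g : P i ⟶ P j) (f : P j ⟶ P k)
    (m : M.obj) : (ZUnit.of (MulOpposite.op (IndRing.ofHom g)) •
      ZUnit.of (MulOpposite.op (IndRing.ofHom f)) • m : M.obj) =
        ZUnit.of (MulOpposite.op (IndRing.ofHom (g ≫ f))) • m := by
  rw [← mul_smul, ← map_mul, ← MulOpposite.op_mul, IndRing.ofHom_mul_ofHom]

lemma smul_ofHom_smul_of_ne {M : UMod (IndRing P)ᵐᵒᵖ} {i j j' k : I} (g : P i ⟶ P j)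
    (f : P j' ⟶ P k) (h : j' ≠ j) (m : M.obj) : (ZUnit.of (MulOpposite.op (IndRing.ofHom g)) •
      ZUnit.of (MulOpposite.op (IndRing.ofHom f)) • m : M.obj) = 0 := by
  rw [← mul_smul, ← map_mul, ← MulOpposite.op_mul, IndRing.ofHom_mul_ofHom_of_ne _ _ h]
  simp

/-- The morphism from `Θ(X)` given by a natural family of maps on `Hom(P i, X)`. -/
def thetaDesc {X : G} {M : UMod (IndRing P)ᵐᵒᵖ} (φ : ∀ i, (P i ⟶ X) →+ M.obj)
    (h : ∀ i j (g : P i ⟶ P j) (f : P j ⟶ X),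
      φ i (g ≫ f) = ZUnit.of (MulOpposite.op (IndRing.ofHom g)) • φ j f) :
    (theta P).obj X ⟶ M := by
  classical
  let q : HomSum P X →+ M.obj := DirectSum.toAddMonoid φ
  have hq (i) (f : P i ⟶ X) : q (HomSum.single f) = φ i f := DirectSum.toAddMonoid_of φ i f
  suffices key : ∀ (a : IndRing P) (x : HomSum P X),
      q (HomSum.act a x) = ZUnit.of (MulOpposite.op a) • q x from
    UMod.homMk q fun a x ↦ (congrArg q (theta_smul a.unop x)).trans (key a.unop x)
  intro a x
  induction x using HomSum.induction with
  | zero => simp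
  | add x y hx hy => rw [map_add, map_add, hx, hy, map_add, smul_add]
  | single k f =>
    rw [hq]
    induction a using IndRing.induction with
    | zero => rw [HomSum.act_zero]; simp
    | add a b ha hb => rw [HomSum.act_add, map_add, ha, hb, MulOpposite.op_add, map_add, add_smul]
    | single i j g =>
      change q (HomSum.act (IndRing.ofHom g) _) = ZUnit.of (MulOpposite.op (IndRing.ofHom g)) • _
      by_cases hkj : k = j
      · subst hkj
        rw [HomSum.act_ofHom_single, hq, h]
      -- By naturality φ k f is fixed by the idempotent of P k, so a morphism into another P j
      -- annihilates it.
      · have := h k k (𝟙 _) f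
        rw [Category.id_comp] at this
        rw [HomSum.act_ofHom_single_of_ne _ _ hkj, map_zero, this, smul_ofHom_smul_of_ne _ _ hkj]

lemma thetaDesc_single {X : G} {M : UMod (IndRing P)ᵐᵒᵖ} (φ : ∀ i, (P i ⟶ X) →+ M.obj)
    (h : ∀ i j (g : P i ⟶ P j) (f : P j ⟶ X),
      φ i (g ≫ f) = ZUnit.of (MulOpposite.op (IndRing.ofHom g)) • φ j f) {i : I} (f : P i ⟶ X) :
    (thetaDesc φ h).hom.hom (HomSum.single f) = φ i f := by
  classical
  exact DirectSum.toAddMonoid_of φ i f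

lemma theta_hom_ext {X : G} {M : UMod (IndRing P)ᵐᵒᵖ} {f g : (theta P).obj X ⟶ M}
    (h : ∀ i (u : P i ⟶ X), f.hom.hom (HomSum.single u) = g.hom.hom (HomSum.single u)) : f = g :=
  UMod.hom_ext fun (x : HomSum P X) ↦ by
    induction x using HomSum.induction with
    | zero => exact (map_zero f.hom.hom).trans (map_zero g.hom.hom).symm
    | single i u => exact h i u
    | add x y hx hy =>
      exact (map_add f.hom.hom _ _).trans ((congrArg₂ _ hx hy).trans (map_add g.hom.hom _ _).symm)

lemma theta_map_apply {X Y : G} (f : X ⟶ Y) (x : HomSum P X) :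
    ((theta P).map f).hom.hom x = HomSum.map f x := rfl

instance : (theta P).Additive where
  map_add {_ _ f g} := UMod.hom_ext fun x ↦ HomSum.map_add f g x

/-- Images of elements of `Hom(P i, X)` under morphisms `Θ(X) ⟶ Θ(Y)`. -/
lemma theta_hom_single {X Y : G} (φ : (theta P).obj X ⟶ (theta P).obj Y) {i : I} (f : P i ⟶ X) :
    φ.hom.hom (HomSum.single f) =
      HomSum.single ((show HomSum P Y from φ.hom.hom (HomSum.single f)) i) := by
  -- The element `single f` is fixed by the idempotent of P i, hence so is its image, which is
  -- therefore concentrated in component `i`.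
  rw [← HomSum.act_id, ← theta_smul]
  refine Eq.trans ?_ (map_smul φ.hom.hom _ _)
  refine congrArg φ.hom.hom (Eq.symm ((theta_smul _ _).trans ?_))
  rw [HomSum.act_ofHom_single, Category.id_comp]

end ThetaEquivalence

/-- Quotients of a module by the same submodule are isomorphic. -/
lemma UMod.nonempty_iso_of_apply_eq_zero_iff {A : Type u} [NonUnitalRing A]
    [HasEnoughIdempotents A] {X Y M : UMod A} (f : X ⟶ Y) (q : X ⟶ M)
    (hf : Function.Surjective f.hom.hom) (hq : Function.Surjective q.hom.hom)
    (h : ∀ x, f.hom.hom x = 0 ↔ q.hom.hom x = 0) : Nonempty (Y ≅ M) := by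
  have : Epi f := (UMod.epi_iff_surjective f).2 hf
  have : Epi q := (UMod.epi_iff_surjective q).2 hq
  let e : Y ⟶ M := Abelian.epiDesc f q (UMod.hom_ext fun x ↦ by
    rw [UMod.comp_apply, UMod.zero_apply, ← h, ← UMod.comp_apply, kernel.condition,
      UMod.zero_apply])
  have he : f ≫ e = q := Abelian.comp_epiDesc _ _ _
  have : Epi e := epi_of_epi_fac he
  have : Mono e := by
    refine (UMod.mono_iff_injective _).2 ((injective_iff_map_eq_zero _).2 fun y hy ↦ ?_)
    obtain ⟨x, rfl⟩ := hf y
    rwa [← UMod.comp_apply, he, ← h] at hy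
  exact ⟨@asIso _ _ _ _ e (isIso_of_mono_of_epi e)⟩

section ThetaIsEquivalence

variable {G : Type u} [Category.{v} G] [Abelian G] {I : Type v} {P : I → G}
  (hP : IsSmallProjectiveGenerating P)

namespace IsSmallProjectiveGenerating

include hP

lemma hom_ext {X Y : G} {f g : X ⟶ Y} (h : ∀ i (u : P i ⟶ X), u ≫ f = u ≫ g) : f = g := by
  refine hP.isSeparating f g ?_
  rintro _ ⟨i⟩ u
  exact h i u

lemma theta_faithful : (theta P).Faithful where
  map_injective {X Y f g} h := hP.hom_ext fun i u ↦ HomSum.single_injective (by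
    rw [← HomSum.map_single, ← HomSum.map_single]
    exact congrArg (fun k : (theta P).obj X ⟶ (theta P).obj Y ↦ k.hom.hom (HomSum.single u)) h)

lemma theta_map_surjective {X Y : G} (f : X ⟶ Y) [Epi f] :
    Function.Surjective ((theta P).map f).hom.hom := by
  intro (y : HomSum P Y)
  induction y using HomSum.induction with
  | zero => exact ⟨0, map_zero _⟩
  | single i u =>
    have := hP.projective i
    refine ⟨HomSum.single (Projective.factorThru u f), (HomSum.map_single _ _).trans ?_⟩
    rw [Projective.factorThru_comp]
  | add x y hx hy =>
    obtain ⟨x, rfl⟩ := hx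
    obtain ⟨y, rfl⟩ := hy
    exact ⟨x + y, map_add _ _ _⟩

variable [IsGrothendieckAbelian.{v} G]

/-- Additive maps from `Hom(P j, ∐ X)` are determined by the composites with the inclusions. -/
lemma addMonoidHom_ext {J : Type v} {X : J → G} {j : I} {T : Type v} [AddCommGroup T]
    {f g : (P j ⟶ ∐ X) →+ T} (h : ∀ l (u : P j ⟶ X l), f (u ≫ Sigma.ι X l) = g (u ≫ Sigma.ι X l)) :
    f = g := by
  have := hP.small j J
  have hc := isColimitOfPreserves (preadditiveCoyoneda.obj (Opposite.op (P j)))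
    (coproductIsCoproduct X)
  have : AddCommGrpCat.ofHom f = AddCommGrpCat.ofHom g := hc.hom_ext fun ⟨l⟩ ↦
    AddCommGrpCat.hom_ext (AddMonoidHom.ext (h l))
  exact congrArg AddCommGrpCat.Hom.hom this

/-- Additive maps from `Hom(P j, ∐ X)` are given by additive maps from the `Hom(P j, X l)`. -/
lemma exists_addMonoidHom {J : Type v} (X : J → G) {j : I} {T : Type v} [AddCommGroup T]
    (φ : ∀ l, (P j ⟶ X l) →+ T) :
    ∃ f : (P j ⟶ ∐ X) →+ T, ∀ l (u : P j ⟶ X l), f (u ≫ Sigma.ι X l) = φ l u := by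
  have := hP.small j J
  have hc := isColimitOfPreserves (preadditiveCoyoneda.obj (Opposite.op (P j)))
    (coproductIsCoproduct X)
  let c : Cocone (Discrete.functor X ⋙ preadditiveCoyoneda.obj (Opposite.op (P j))) :=
    { pt := AddCommGrpCat.of T
      ι := Discrete.natTrans fun l ↦ AddCommGrpCat.ofHom (φ l.as) }
  refine ⟨(hc.desc c).hom, fun l u ↦ ?_⟩
  have := hc.fac c ⟨l⟩
  exact DFunLike.congr_fun (congrArg AddCommGrpCat.Hom.hom this) u

/-- A morphism of modules gives maps a_i : Hom(P i, X) → Hom(P i, Y) natural in P i. They define `F`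
on the coproduct of all P i over all morphisms P i ⟶ X, and `F` descends along the canonical
epimorphism to `X`. -/
lemma theta_full : (theta P).Full where
  map_surjective {X Y} φ := by
    choose a ha using fun (i : I) (f : P i ⟶ X) ↦
      (⟨_, theta_hom_single φ f⟩ : ∃ g : P i ⟶ Y, φ.hom.hom (HomSum.single f) = HomSum.single g)
    have hadd (i) (f g : P i ⟶ X) : a i (f + g) = a i f + a i g := HomSum.single_injective (by
      rw [← ha, map_add, map_add, ← ha, ← ha]
      exact map_add φ.hom.hom _ _)
    have hcomp (i j) (g : P i ⟶ P j) (f : P j ⟶ X) : a i (g ≫ f) = g ≫ a j f :=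
      HomSum.single_injective (by
        rw [← ha, ← HomSum.act_ofHom_single, ← theta_smul, ← HomSum.act_ofHom_single, ← ha]
        exact (map_smul φ.hom.hom _ _).trans (theta_smul _ _))
    let J := Σ i, (P i ⟶ X)
    let p : (∐ fun l : J ↦ P l.1) ⟶ X := Sigma.desc fun l ↦ l.2
    let F : (∐ fun l : J ↦ P l.1) ⟶ Y := Sigma.desc fun l ↦ a l.1 l.2
    have : Epi p := ⟨fun {Z} f g h ↦ hP.hom_ext fun i u ↦ by
      have := congrArg (Sigma.ι (fun l : J ↦ P l.1) ⟨i, u⟩ ≫ ·) h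
      simpa [p] using this⟩
    -- Smallness enters here: both sides are additive in `w`, so it is enough to compare them for
    -- `w` through a single summand. It follows that `F` kills ker p.
    have hF (i) (w : P i ⟶ ∐ fun l : J ↦ P l.1) : w ≫ F = a i (w ≫ p) := by
      refine DFunLike.congr_fun (hP.addMonoidHom_ext (f := Preadditive.rightComp (P i) F)
        (g := (AddMonoidHom.mk' (a i) (hadd i)).comp (Preadditive.rightComp (P i) p))
        fun l u ↦ ?_) w
      change (u ≫ Sigma.ι (fun l : J ↦ P l.1) l) ≫ F = a i ((u ≫ Sigma.ι (fun l : J ↦ P l.1) l) ≫ p)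
      simp [F, p, hcomp]
    have hk : kernel.ι p ≫ F = 0 := hP.hom_ext fun i u ↦ by
      rw [← Category.assoc, hF, Category.assoc, kernel.condition, comp_zero, comp_zero]
      exact map_zero (AddMonoidHom.mk' (a i) (hadd i))
    refine ⟨Abelian.epiDesc p F hk, theta_hom_ext fun i u ↦ ?_⟩
    rw [theta_map_apply, HomSum.map_single, ha]
    refine congrArg _ ?_
    have h1 : Sigma.ι (fun l : J ↦ P l.1) ⟨i, u⟩ ≫ p = u := Sigma.ι_desc _ _
    conv_lhs => rw [← h1, Category.assoc, Abelian.comp_epiDesc]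
    exact Sigma.ι_desc _ _

/-- `M` is presented by generators and relations: one copy of P i for each m in M e_i, and one for
each w : P i ⟶ ∐ X sent to zero in `M`. The cokernel in `G` of the relations is mapped by `Θ` to
`M`, because Θ(∐ X) → Θ(coker d) and Θ(∐ X) → M are surjective with the same kernel. -/
lemma theta_essSurj : (theta P).EssSurj where
  mem_essImage M := by
    let J := Σ i, {m : M.obj // ZUnit.of (MulOpposite.op (IndRing.ofHom (𝟙 (P i)))) • m = m}
    let X (l : J) : G := P l.1
    have hφ (i : I) := hP.exists_addMonoidHom (j := i) X (T := M.obj) fun l ↦ AddMonoidHom.mk'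
      (fun u ↦ ZUnit.of (MulOpposite.op (IndRing.ofHom u)) • l.2.1) fun u u' ↦ by
        rw [← add_smul, ← map_add, ← MulOpposite.op_add]
        simp [IndRing.ofHom]
    choose φ hφ using hφ
    have hnat (i j) (g : P i ⟶ P j) (f : P j ⟶ ∐ X) :
        φ i (g ≫ f) = ZUnit.of (MulOpposite.op (IndRing.ofHom g)) • φ j f := by
      refine DFunLike.congr_fun (hP.addMonoidHom_ext
        (f := (φ i).comp (Preadditive.leftComp _ g))
        (g := (DistribSMul.toAddMonoidHom M.obj
          (ZUnit.of (MulOpposite.op (IndRing.ofHom g)))).comp (φ j)) fun l u ↦ ?_) f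
      change φ i (g ≫ u ≫ Sigma.ι X l) =
        ZUnit.of (MulOpposite.op (IndRing.ofHom g)) • φ j (u ≫ Sigma.ι X l)
      rw [← Category.assoc, hφ, hφ]
      exact (smul_ofHom_smul g u l.2.1).symm
    let q : (theta P).obj (∐ X) ⟶ M := thetaDesc φ hnat
    have hq {i} (f : P i ⟶ ∐ X) : q.hom.hom (HomSum.single f) = φ i f := thetaDesc_single φ hnat f
    let J' := Σ i, {w : P i ⟶ ∐ X // φ i w = 0}
    let d : (∐ fun l : J' ↦ P l.1) ⟶ ∐ X := Sigma.desc fun l ↦ l.2.1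
    let c := cokernel.π d
    have hd (i) (y : P i ⟶ ∐ fun l : J' ↦ P l.1) : φ i (y ≫ d) = 0 := by
      refine DFunLike.congr_fun (hP.addMonoidHom_ext
        (f := (φ i).comp (Preadditive.rightComp _ d)) (g := 0) fun l u ↦ ?_) y
      change φ i ((u ≫ Sigma.ι (fun l : J' ↦ P l.1) l) ≫ d) = 0
      simp [d, hnat, l.2.2]
    -- Each component of `x` lands in ker c, the image of `d`, and lifts through `d` because P i is
    -- projective; so it is a combination of relations.
    have h1 (x : HomSum P (∐ X)) (hx : HomSum.map c x = 0) : q.hom.hom x = 0 := by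
      refine HomSum.map_eq_zero_of_forall q.hom.hom.toAddMonoidHom x fun i ↦ ?_
      have := hP.projective i
      have hxi : x i ≫ c = 0 := congrArg (fun y : HomSum P (cokernel d) ↦ y i) hx
      have h : Projective.factorThru (kernel.lift c (x i) hxi) (Abelian.factorThruImage d) ≫ d =
          x i := by
        refine (congrArg (_ ≫ ·) (Abelian.image.fac d).symm).trans ?_
        rw [Projective.factorThru_comp_assoc]
        exact kernel.lift_ι _ _ _
      refine (hq _).trans ?_
      rw [← h, hd]
    -- Multiplying by the idempotents shows that each component of `x` is killed by `φ`, hence is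
    -- itself one of the relations.
    have h2 (x : HomSum P (∐ X)) (hx : q.hom.hom x = 0) : HomSum.map c x = 0 := by
      refine DirectSum.ext fun i ↦ ?_
      have hi : φ i (x i) = 0 := by
        rw [← hq, ← HomSum.act_id, ← theta_smul]
        exact (map_smul q.hom.hom _ _).trans ((congrArg _ hx).trans (smul_zero _))
      change x i ≫ c = 0
      have : x i = Sigma.ι (fun l : J' ↦ P l.1) ⟨i, x i, hi⟩ ≫ d :=
        (Sigma.ι_desc (fun l : J' ↦ l.2.1) ⟨i, x i, hi⟩).symm
      rw [this, Category.assoc, cokernel.condition, comp_zero]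
    have hsurj : Function.Surjective q.hom.hom := by
      intro m
      obtain ⟨a, ha⟩ := UMod.exists_localUnit M m
      obtain ⟨a, rfl⟩ := MulOpposite.op_surjective a
      rw [← LinearMap.mem_range, ← ha]
      clear ha
      induction a using IndRing.induction with
      | zero => simp
      | add a b ha hb => rw [MulOpposite.op_add, map_add, add_smul]; exact add_mem ha hb
      | single i j f =>
        have hi := smul_ofHom_smul (𝟙 (P i)) f m
        rw [Category.id_comp] at hi
        refine ⟨HomSum.single (Sigma.ι X ⟨i, _, hi⟩), (hq _).trans ?_⟩
        have := hφ i ⟨i, _, hi⟩ (𝟙 (P i))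
        rw [AddMonoidHom.mk'_apply, hi] at this
        rw [← Category.id_comp (Sigma.ι X _)]
        exact this
    obtain ⟨e⟩ := UMod.nonempty_iso_of_apply_eq_zero_iff ((theta P).map c) q
      (hP.theta_map_surjective c) hsurj fun x ↦ ⟨h1 x, h2 x⟩
    exact ⟨cokernel d, ⟨e⟩⟩

/-- The functor `Θ` is an equivalence of categories. -/
lemma theta_isEquivalence : (theta P).IsEquivalence where
  faithful := hP.theta_faithful
  full := hP.theta_full
  essSurj := hP.theta_essSurj

end IsSmallProjectiveGenerating

end ThetaIsEquivalence

/-! ### The main theorem -/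

/-! ### Invariance of Ext vanishing and of FP_n-injectivity under isomorphisms and equivalences. -/

section Isomorphism

variable {C : Type u} [Category.{v} C] [Abelian C] [HasExt.{w} C]

lemma subsingleton_ext_congr_left {X X' : C} (e : X ≅ X') (Y : C) (n : ℕ) :
    Subsingleton (Abelian.Ext X Y n) ↔ Subsingleton (Abelian.Ext X' Y n) :=
  ((((Abelian.extFunctor n).mapIso e.op).app Y).addCommGroupIsoToAddEquiv.toEquiv
    |>.subsingleton_congr).symm

lemma subsingleton_ext_congr_right (X : C) {Y Y' : C} (e : Y ≅ Y') (n : ℕ) :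
    Subsingleton (Abelian.Ext X Y n) ↔ Subsingleton (Abelian.Ext X Y' n) :=
  ((Abelian.extFunctorObj X n).mapIso e).addCommGroupIsoToAddEquiv.toEquiv.subsingleton_congr

/-- The orthogonal classes of classes of objects are closed under isomorphisms. -/
lemma perpOne_congr {C : Type u} [Category.{v} C] [Abelian C] [HasExt.{v} C]
    (𝒞 : ObjectProperty C) {Y Y' : C} (e : Y ≅ Y') : perpOne 𝒞 Y ↔ perpOne 𝒞 Y' :=
  forall₂_congr fun X _ ↦ subsingleton_ext_congr_right X e 1

/-- An equivalence preserves and reflects `FP_n`-injective objects. -/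
lemma isFPInjective_map_iff {C : Type u} [Category.{v} C] [Abelian C] [HasExt.{v} C]
    [EnoughInjectives C] {D : Type w} [Category.{v} D] [Abelian D] [HasExt.{v} D]
    (F : C ⥤ D) [F.Additive] [F.IsEquivalence] (n : ℕ) (Y : C) :
    isFPInjective D n (F.obj Y) ↔ isFPInjective C n Y := by
  -- The quasi-inverse is needed too: an arbitrary `X` of type FP_n in `D` is replaced by `F` of
  -- `F.inv X`, which has type FP_n by `isFP_map_iff` for `F.inv`.
  have : EnoughInjectives D := EnoughInjectives.of_equivalence F.inv
  have : F.asEquivalence.functor.Additive := ‹F.Additive›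
  have : F.inv.Additive := F.asEquivalence.inverse_additive
  refine ⟨fun h X hX ↦ (subsingleton_ext_map_iff F X Y 1).1 (h _ ((isFP_map_iff F n X).2 hX)),
    fun h X hX ↦ ?_⟩
  let e : X ≅ F.obj (F.inv.obj X) := (F.asEquivalence.counitIso.app X).symm
  exact (subsingleton_ext_congr_left e _ 1).2
    ((subsingleton_ext_map_iff F _ Y 1).2 (h _ ((isFP_map_iff F.inv n X).2 hX)))

end Isomorphism

/-! ### Tor of character modules against modules of type FP_2. -/

section Bidual

variable {A : Type u} [NonUnitalRing A] [HasEnoughIdempotents A]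

lemma subsingleton_tor_one_congr {N N' : UMod Aᵐᵒᵖ} (e : N ≅ N') (M : UMod A) :
    Subsingleton (tor 1 N M) ↔ Subsingleton (tor 1 N' M) := by
  rw [subsingleton_tor_one_iff', subsingleton_tor_one_iff', subsingleton_ext_congr_left e]

/-- `Tor_1(M⁺, F)` vanishes iff `Ext^1(F, M)` vanishes, for left modules `F` of type `FP_2`. -/
lemma subsingleton_tor_one_char_iff {n : ℕ} (hn : 2 ≤ n) {F : UMod A} (hF : isFP (UMod A) n F)
    (M : UMod A) : Subsingleton (tor 1 M.char F) ↔ Subsingleton (Abelian.Ext F M 1) :=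
  (subsingleton_tor_one_iff _ _).trans (subsingleton_ext_bidual_iff (φ := .id Aᵐᵒᵖ)
    (ψ := (RingEquiv.opOp A : A →ₙ+* Aᵐᵒᵖᵐᵒᵖ)) (fun _ ↦ rfl) hn hF M)

/-- `Tor_1(F, N⁺)` vanishes iff `Ext^1(F, N)` vanishes, for right modules `F` of type `FP_2`. -/
lemma subsingleton_tor_one_charOp_iff {n : ℕ} (hn : 2 ≤ n) {F : UMod Aᵐᵒᵖ}
    (hF : isFP (UMod Aᵐᵒᵖ) n F) (N : UMod Aᵐᵒᵖ) :
    Subsingleton (tor 1 F N.charOp) ↔ Subsingleton (Abelian.Ext F N 1) :=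
  (subsingleton_tor_one_iff' _ _).trans (subsingleton_ext_bidual_iff
    (φ := (RingEquiv.opOp A : A →ₙ+* Aᵐᵒᵖᵐᵒᵖ)) (ψ := .id Aᵐᵒᵖ) (fun _ ↦ rfl) hn hF N)

end Bidual

theorem mainTheorem9 {G : Type u} [Category.{v} G] [Abelian G] [IsGrothendieckAbelian.{v} G]
    {I : Type v} (P : I → G) (hP : IsSmallProjectiveGenerating P) :
    ∃ _ : (theta P).IsEquivalence,
      ∀ (n : ℕ) (𝒞 : ObjectProperty (UMod (IndRing P))) (𝒞' : ObjectProperty G),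
        𝒞 ≤ isFP (UMod (IndRing P)) n → 𝒞' ≤ isFP G n →
        ∀ (N : G) (M : UMod (IndRing P)),
          ((leftTop P 𝒞 N ↔ perpOne 𝒞 ((theta P).obj N).charOp) ∧
            (isFPFlat P n N ↔
              isFPInjective (UMod (IndRing P)) n ((theta P).obj N).charOp)) ∧
          ((rightTop P 𝒞' M ↔ perpOne 𝒞' ((theta P).inv.obj M.char)) ∧
            (isFPFlatModule (IndRing P) n M ↔
              isFPInjective G n ((theta P).inv.obj M.char))) ∧
          (2 ≤ n →
            (perpOne 𝒞 M ↔ leftTop P 𝒞 ((theta P).inv.obj M.char)) ∧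
            (isFPInjective (UMod (IndRing P)) n M ↔
              isFPFlat P n ((theta P).inv.obj M.char))) ∧
          (2 ≤ n →
            (perpOne 𝒞' N ↔ rightTop P 𝒞' ((theta P).obj N).charOp) ∧
            (isFPInjective G n N ↔
              isFPFlatModule (IndRing P) n ((theta P).obj N).charOp)) := by
  have hE := hP.theta_isEquivalence
  refine ⟨hE, fun n 𝒞 𝒞' h𝒞 h𝒞' N M ↦ ?_⟩
  let e : (theta P).obj ((theta P).inv.obj M.char) ≅ M.char :=
    (theta P).asEquivalence.counitIso.app M.char
  have h1 (𝒟 : ObjectProperty (UMod (IndRing P))) :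
      leftTop P 𝒟 N ↔ perpOne 𝒟 ((theta P).obj N).charOp :=
    forall₂_congr fun F _ ↦ subsingleton_tor_one_iff _ F
  have h3 (hn : 2 ≤ n) (𝒟 : ObjectProperty (UMod (IndRing P)))
      (h𝒟 : 𝒟 ≤ isFP (UMod (IndRing P)) n) :
      perpOne 𝒟 M ↔ leftTop P 𝒟 ((theta P).inv.obj M.char) :=
    forall₂_congr fun F hF ↦ ((subsingleton_tor_one_congr e F).trans
      (subsingleton_tor_one_char_iff hn (h𝒟 F hF) M)).symm
  refine ⟨⟨h1 𝒞, h1 _⟩, ⟨forall₂_congr fun F _ ↦ ?_, ?_⟩,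
    fun hn ↦ ⟨h3 hn 𝒞 h𝒞, h3 hn _ le_rfl⟩, fun hn ↦ ⟨forall₂_congr fun F hF ↦ ?_, ?_⟩⟩
  -- Tor_1(Θ F, M) is exchanged for Ext^1(Θ F, M⁺); then M⁺ is replaced by `Θ` of its preimage and
  -- Ext is transported back to `G`.
  · rw [subsingleton_tor_one_iff', ← subsingleton_ext_congr_right _ e, subsingleton_ext_map_iff]
  -- FP_n-flatness of `M` tests against all right modules of type FP_n, not only those of the form
  -- Θ(F), so FP_n-injectivity is moved to the module side.
  · rw [← isFPInjective_map_iff (theta P)]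
    exact (forall₂_congr fun F _ ↦ (subsingleton_tor_one_iff' F M)).trans
      (perpOne_congr _ e).symm
  · rw [subsingleton_tor_one_charOp_iff hn ((isFP_map_iff (theta P) n F).2 (h𝒞' F hF)),
      subsingleton_ext_map_iff]
  · rw [← isFPInjective_map_iff (theta P)]
    exact forall₂_congr fun F hF ↦ (subsingleton_tor_one_charOp_iff hn hF _).symm

end
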